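/- Let $\mathbb F_q$ denote the finite field with $q=p^m$ elements ($p$ prime, $m\ge 1$), let $\mathrm{Tr}(x)=\sum_{i=0}^{m-1}x^{p^i}$ be the absolute trace and $\psi(x)=\exp(2\pi i\,\mathrm{Tr}(x)/p)$. There is a function $e:\mathbb N\to\mathbb R$ with $e(q)\to 0$ as $q\to\infty$ such that for every $C>0$ there is a constant $K>0$, depending only on $C$, with the following property. Let $q$ be any prime power and let $X,Y,Z\subset\mathbb F_q$ satisfy $|X|\ge|Y|\ge|Z|$ and $0\notin Z$, and suppose that $$|X\cap cG|\le C\,|G|^{1/2}$$ for all proper subfields $G$ of $\mathbb F_q$ and all $c\in\mathbb F_q$. Then for all complex weights $(\alpha_x)_{x\in X}$, $(\beta_y)_{y\in Y}$, $(\gamma_z)_{z\in Z}$ of modulus at most $1$, $$\Big|\sum_{x\in X}\sum_{y\in Y}\sum_{z\in Z}\alpha_x\beta_y\gamma_z\psi(xyz)\Big|\le K\Big(q^{9/32+e(q)}|X|^{95/128}|Y|^{3/4}|Z|^{15/16}+q^{17/58+e(q)}|X|^{43/58}|Y|^{87/116}|Z|^{53/58}+q^{35/128+e(q)}|X|^{97/128}|Y|^{3/4}|Z|^{15/16}\Big).$$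 -/

import Mathlib

/-- The canonical additive character `ψ(x) = exp(2πi Tr(x)/p)` of a finite field `F` of
characteristic `p`, where `Tr` is the absolute trace from `F` to the prime field `ZMod p`. -/
noncomputable def canonicalChar (p : ℕ) [Fact p.Prime] (F : Type*) [Field F] [Fintype F]
    [Algebra (ZMod p) F] (x : F) : ℂ :=
  Complex.exp (2 * Real.pi * Complex.I * ((Algebra.trace (ZMod p) F x).val : ℂ) / (p : ℂ))

/-- `|X ∩ cG| ≤ C |G|^{1/2}` for all proper subfields `G` of `F` and all elements `c` of `F`. -/
def SmallOnSubfieldDilates {F : Type*} [Field F] (C : ℝ) (X : Finset F) : Prop :=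
  ∀ G : Subfield F, G ≠ ⊤ → ∀ c : F,
    (((X : Set F) ∩ (fun g : F => c * g) '' (G : Set F)).ncard : ℝ) ≤ C * Real.sqrt (Nat.card G)

/-! Write g(x) for the inner sum over y and z. Up to a logarithm, the trilinear sum is at most t|A|,
where A is a set of nonzero elements of X on which |g| ≥ t (`trilinear_le_level_set`); the
exceptional case is a trivially small sum. For any A' ⊆ A, a choice of phases makes t|A'| a lower
bound for a trilinear sum over A', Y, Z. Cauchy–Schwarz and Parseval bound that sum from above
through the multiplicative energy of A', and also through its additive energy
(`energies_of_large_sum`). So a large sum makes both energies large, and this persists on subsets of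
A.

Additive energy is converted by `balog_szemeredi_gowers` into a subset A' with |A' - A'| and |2A' -
2A'| small. Since g is still large on A', its multiplicative energy is large too, and
`sum_product_energy` limits how far these two properties can coexist. There, multiplicative energy
supplies x₀ with many products xy in B = x₀A', and then a subset D on which this relation has large
minimal degree. Let R be the set of quotients of differences of D. If R is not stable under r ↦ r +
1, or under r ↦ (e/x₀)r for some e in D, then an element outside R makes a linear map on pairs
injective, while covering by translates of B confines its image (`pivot_add_one`, `pivot_mul`).
Otherwise R is a subfield with D ⊆ x₀R, and averaging over ξ in R produces a dilate for which D + ξD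
is large, again against the covering bound (`field_case`). The hypothesis on dilates of subfields
bounds |D| when R is proper.

The three outcomes become the three terms: the middle one comes from the pivots, the last from R = F
with |D|² > q, the first from the remaining field cases. The graph density α in the
Balog–Szemerédi–Gowers step stays explicit until its powers cancel or can be bounded. Logarithms go
into q^{e(q)}, and |Z| ≤ |Y| trades powers of |Z| for powers of |Y|. -/

namespace TrilinearSum

open Finset
open scoped Pointwise ComplexConjugate

/-! ### Pigeonholing onto level sets -/

/-- A nonnegative function on a finite set has a superlevel set carrying its sum up to a harmonic
factor. -/
theorem sum_le_harmonic_mul_of_forall {ι : Type*} [DecidableEq ι] (f : ι → ℝ) (B : ℝ) :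
    ∀ s : Finset ι, (∀ t : ℝ, t * #{x ∈ s | t ≤ f x} ≤ B) →
      ∑ x ∈ s, f x ≤ B * (harmonic #s : ℝ) := by
  intro s
  induction s using Finset.strongInduction with
  | H s ih =>
    intro h
    rcases s.eq_empty_or_nonempty with rfl | hs
    · simp
    obtain ⟨m, hm, hmin⟩ := s.exists_min_image f hs
    -- The threshold f m captures all of s, so the minimiser contributes at most B/#s; removing
    -- minimisers one at a time adds these up to a harmonic sum.
    have h1 : f m * #s ≤ B := by
      have := h (f m)
      rwa [filter_true_of_mem (fun x hx => hmin x hx)] at this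
    have hB : 0 ≤ B := by simpa using h 0
    have hcard : #s = #(s.erase m) + 1 := by
      rw [card_erase_of_mem hm]; have := hs.card_pos; omega
    have h2 : ∑ x ∈ s.erase m, f x ≤ B * (harmonic #(s.erase m) : ℝ) := by
      refine ih _ (erase_ssubset hm) fun t => ?_
      rcases le_or_gt t 0 with ht | ht
      · exact (mul_nonpos_of_nonpos_of_nonneg ht (Nat.cast_nonneg _)).trans hB
      · refine le_trans ?_ (h t)
        gcongr
        exact erase_subset _ _
    have hpos : (0 : ℝ) < #s := by exact_mod_cast hs.card_pos
    rw [← add_sum_erase _ _ hm, hcard, harmonic_succ]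
    push_cast
    have h3 : f m ≤ B * ((#(s.erase m) : ℝ) + 1)⁻¹ := by
      rw [← div_eq_mul_inv, le_div_iff₀ (by positivity)]
      have : ((#s : ℕ) : ℝ) = #(s.erase m) + 1 := by rw [hcard]; push_cast; ring
      rwa [← this]
    linarith

/-- Take the threshold among the values of f that maximises t · #{f ≥ t}. Any other positive t can
be raised to the least value of f above it without changing the level set, so this maximum serves as
the bound B in the harmonic estimate. -/
theorem exists_sum_le_log_mul {ι : Type*} [DecidableEq ι] (s : Finset ι) (hs : s.Nonempty)
    (f : ι → ℝ) (hf : 0 < ∑ x ∈ s, f x) :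
    ∃ t : ℝ, 0 < t ∧
      ∑ x ∈ s, f x ≤ (1 + Real.log #s) * (t * #{x ∈ s | t ≤ f x}) := by
  by_contra! hcon
  have hlog : 0 ≤ Real.log (#s : ℝ) := Real.log_natCast_nonneg _
  obtain ⟨x₀, hx₀⟩ := hs
  obtain ⟨x₁, hx₁, hmax⟩ := s.exists_max_image (fun y => f y * #{x ∈ s | f y ≤ f x}) ⟨x₀, hx₀⟩
  set B : ℝ := f x₁ * #{x ∈ s | f x₁ ≤ f x} with hB
  have hB0 : 0 ≤ B := by
    obtain ⟨y, hy, hy0⟩ := exists_lt_of_sum_lt (s := s) (f := fun _ => (0 : ℝ)) (g := f) (by simpa)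
    exact le_trans (by positivity) (hmax y hy)
  have key : ∀ t : ℝ, t * #{x ∈ s | t ≤ f x} ≤ B := by
    intro t
    rcases le_or_gt t 0 with ht | ht
    · exact (mul_nonpos_of_nonpos_of_nonneg ht (Nat.cast_nonneg _)).trans hB0
    rcases (filter (fun x => t ≤ f x) s).eq_empty_or_nonempty with he | hne
    · rw [he]; simpa using hB0
    obtain ⟨m, hm, hmin⟩ := exists_min_image _ f hne
    rw [mem_filter] at hm
    refine le_trans ?_ (hmax m hm.1)
    have : ({x ∈ s | t ≤ f x} : Finset ι) ⊆ {x ∈ s | f m ≤ f x} := by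
      intro x hx
      rw [mem_filter]
      exact ⟨(mem_filter.1 hx).1, hmin x hx⟩
    have h2 := card_le_card this
    have h3 : (#{x ∈ s | t ≤ f x} : ℝ) ≤ #{x ∈ s | f m ≤ f x} := by exact_mod_cast h2
    exact mul_le_mul hm.2 h3 (by positivity) (ht.le.trans hm.2)
  have h1 := sum_le_harmonic_mul_of_forall f B s key
  have h2 : (harmonic #s : ℝ) ≤ 1 + Real.log #s := harmonic_le_one_add_log _
  have hBpos : 0 < B := by
    rcases hB0.lt_or_eq with h | h
    · exact h
    · rw [← h, zero_mul] at h1; exact absurd h1 (not_le.2 hf)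
  have h4 : 0 < f x₁ := by
    by_contra! h0
    exact absurd hBpos (not_lt.2 (mul_nonpos_of_nonpos_of_nonneg h0 (Nat.cast_nonneg _)))
  have h5 := hcon (f x₁) h4
  have h6 : B * (harmonic #s : ℝ) ≤ B * (1 + Real.log #s) := by gcongr
  rw [← hB] at h5
  linarith

/-! ### Plünnecke inequalities -/

/-- A set minimizing the doubling ratio against `B` among the nonempty subsets of `A`. -/
theorem exists_petridis_subset {G : Type*} [AddCommGroup G] [DecidableEq G] (A B : Finset G)
    (hA : A.Nonempty) :
    ∃ X ⊆ A, X.Nonempty ∧ #(X + B) * #A ≤ #(A + B) * #X ∧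
      ∀ C : Finset G, #(X + B + C) * #X ≤ #(X + B) * #(X + C) := by
  classical
  obtain ⟨X, hX, hmin⟩ := exists_min_image (A.powerset.erase ∅)
    (fun X => (#(X + B) : ℚ) / #X) ⟨A, by simp [hA.ne_empty]⟩
  simp only [mem_erase, mem_powerset, ne_eq, and_imp] at hX hmin
  have hXne : X.Nonempty := nonempty_iff_ne_empty.2 hX.1
  have hXpos : (0 : ℚ) < #X := by exact_mod_cast hXne.card_pos
  have main : ∀ Y ⊆ A, #(X + B) * #Y ≤ #(Y + B) * #X := by
    intro Y hY
    rcases Y.eq_empty_or_nonempty with rfl | hYne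
    · simp
    have h := hmin Y hYne.ne_empty hY
    have hYpos : (0 : ℚ) < #Y := by exact_mod_cast hYne.card_pos
    rw [div_le_div_iff₀ hXpos hYpos] at h
    exact_mod_cast h
  refine ⟨X, hX.2, hXne, main A subset_rfl, fun C => ?_⟩
  have := pluennecke_petridis_inequality_add (A := X) (B := B) C
    (fun Y hY => main Y (hY.trans hX.2))
  simpa [add_comm, add_left_comm, add_assoc] using this

/-- The Plünnecke inequality for two different summands, with an absolute constant. -/
theorem pluennecke_two_summands {G : Type*} [AddCommGroup G] [DecidableEq G]
    (A B₁ B₂ : Finset G) (hA : A.Nonempty) (hB₁ : B₁.Nonempty) (hB₂ : B₂.Nonempty) :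
    ∃ X ⊆ A, X.Nonempty ∧
      #(X + B₁ + B₂) * #A ^ 2 ≤ 4 * (#(A + B₁) * #(A + B₂)) * #X := by
  classical
  set t₁ := #(A + B₂) with ht₁
  set t₂ := #(A + B₁) with ht₂
  have ht₁0 : 0 < t₁ := (hA.add hB₂).card_pos
  have ht₂0 : 0 < t₂ := (hA.add hB₁).card_pos
  -- B₁ and B₂ are lengthened along independent integer directions, each by the size of the other
  -- sumset, so that both halves of A' + B have at most t₁t₂ elements. The one-summand inequality
  -- for B then balances the two summands.
  let T₁ : Finset (ℤ × ℤ) := (Ico (0 : ℤ) t₁) ×ˢ {0}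
  let T₂ : Finset (ℤ × ℤ) := {0} ×ˢ (Ico (0 : ℤ) t₂)
  let A' : Finset (G × ℤ × ℤ) := A ×ˢ {(0, 0)}
  let B : Finset (G × ℤ × ℤ) := B₁ ×ˢ T₁ ∪ B₂ ×ˢ T₂
  have hA'ne : A'.Nonempty := hA.product (singleton_nonempty _)
  obtain ⟨X', hX'A, hX'ne, hr, hP⟩ := exists_petridis_subset A' B hA'ne
  have hT₁ : #T₁ = t₁ := by simp [T₁]
  have hT₂ : #T₂ = t₂ := by simp [T₂]
  have hcA' : #A' = #A := by simp [A']
  have hAB : #(A' + B) ≤ 2 * (t₁ * t₂) := by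
    have hsub : A' + B ⊆ (A + B₁) ×ˢ T₁ ∪ (A + B₂) ×ˢ T₂ := by
      intro z hz
      obtain ⟨a, ha, b, hb, rfl⟩ := mem_add.1 hz
      obtain ⟨a1, a2⟩ := a
      obtain ⟨b1, b2⟩ := b
      simp only [A', mem_product, mem_singleton] at ha
      obtain ⟨ha1, rfl⟩ := ha
      rcases mem_union.1 hb with hb | hb
      · rw [mem_product] at hb
        refine mem_union_left _ (mem_product.2 ⟨add_mem_add ha1 hb.1, ?_⟩)
        change ((0 : ℤ), (0 : ℤ)) + b2 ∈ T₁
        rw [show ((0 : ℤ), (0 : ℤ)) + b2 = b2 from zero_add b2]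
        exact hb.2
      · rw [mem_product] at hb
        refine mem_union_right _ (mem_product.2 ⟨add_mem_add ha1 hb.1, ?_⟩)
        change ((0 : ℤ), (0 : ℤ)) + b2 ∈ T₂
        rw [show ((0 : ℤ), (0 : ℤ)) + b2 = b2 from zero_add b2]
        exact hb.2
    calc #(A' + B) ≤ _ := card_le_card hsub
      _ ≤ _ := card_union_le _ _
      _ = 2 * (t₁ * t₂) := by rw [card_product (A + B₁) T₁, card_product (A + B₂) T₂, hT₁, hT₂]; ring
  set X : Finset G := X'.image Prod.fst with hX
  have hX' : X' = X ×ˢ {(0, 0)} := by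
    ext ⟨a, b⟩
    simp only [hX, mem_product, mem_singleton, mem_image]
    constructor
    · intro h
      have := hX'A h
      simp only [A', mem_product, mem_singleton] at this
      exact ⟨⟨_, h, rfl⟩, this.2⟩
    · rintro ⟨⟨⟨c, d⟩, h, rfl⟩, rfl⟩
      have := hX'A h
      simp only [A', mem_product, mem_singleton] at this
      rw [← this.2]; exact h
  have hcX : #X' = #X := by rw [hX']; simp
  have hXA : X ⊆ A := by
    intro a ha
    obtain ⟨z, hz, rfl⟩ := mem_image.1 ha
    have := hX'A hz
    simp only [A', mem_product, mem_singleton] at this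
    exact this.1
  have hXne : X.Nonempty := hX'ne.image _
  -- The mixed part of B + B carries a full t₁ × t₂ box of integer coordinates above every b₁ + b₂.
  have hlow : #(X + B₁ + B₂) * (t₁ * t₂) ≤ #(X' + B + B) := by
    have : #((X + B₁ + B₂) ×ˢ ((Ico (0 : ℤ) t₁) ×ˢ (Ico (0 : ℤ) t₂)))
        = #(X + B₁ + B₂) * (t₁ * t₂) := by simp [card_product]
    rw [← this]
    refine card_le_card ?_
    rintro ⟨z, i, j⟩ hz
    simp only [mem_product] at hz
    obtain ⟨hz, hi, hj⟩ := hz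
    obtain ⟨xb, hxb, b₂, hb₂, rfl⟩ := mem_add.1 hz
    obtain ⟨x, hx, b₁, hb₁, rfl⟩ := mem_add.1 hxb
    have h1 : ((x, 0, 0) : G × ℤ × ℤ) ∈ X' := by rw [hX']; simp [hx]
    have h2 : ((b₁, i, 0) : G × ℤ × ℤ) ∈ B :=
      mem_union_left _ (mem_product.2 ⟨hb₁, mem_product.2 ⟨hi, mem_singleton_self _⟩⟩)
    have h3 : ((b₂, 0, j) : G × ℤ × ℤ) ∈ B :=
      mem_union_right _ (mem_product.2 ⟨hb₂, mem_product.2 ⟨mem_singleton_self _, hj⟩⟩)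
    have := add_mem_add (add_mem_add h1 h2) h3
    simpa using this
  have hPB := hP B
  rw [hcX] at hPB hr
  rw [hcA'] at hr
  refine ⟨X, hXA, hXne, ?_⟩
  have hXpos : 0 < #X := hXne.card_pos
  set s := #(X' + B)
  have e1 : s * #A ≤ 2 * (t₁ * t₂) * #X := hr.trans (Nat.mul_le_mul_right _ hAB)
  have e2 : #(X + B₁ + B₂) * (t₁ * t₂) * #X ≤ s * s :=
    (Nat.mul_le_mul_right _ hlow).trans hPB
  have e3 : (#(X + B₁ + B₂) * #A ^ 2) * ((t₁ * t₂) * #X)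
      ≤ (4 * (t₂ * t₁) * #X) * ((t₁ * t₂) * #X) := by
    calc (#(X + B₁ + B₂) * #A ^ 2) * ((t₁ * t₂) * #X)
        = (#(X + B₁ + B₂) * (t₁ * t₂) * #X) * #A ^ 2 := by ring
      _ ≤ (s * s) * #A ^ 2 := Nat.mul_le_mul_right _ e2
      _ = (s * #A) * (s * #A) := by ring
      _ ≤ (2 * (t₁ * t₂) * #X) * (2 * (t₁ * t₂) * #X) := Nat.mul_le_mul e1 e1
      _ = _ := by ring
  exact Nat.le_of_mul_le_mul_right e3 (Nat.mul_pos (Nat.mul_pos ht₁0 ht₂0) hXpos)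

/-! ### Dependent random choice -/

theorem sum_card_filter_comm {V W : Type*} (A : Finset V) (B : Finset W) (r : V → W → Prop)
    [∀ a b, Decidable (r a b)] :
    ∑ a ∈ A, (#{b ∈ B | r a b} : ℝ) = ∑ b ∈ B, (#{a ∈ A | r a b} : ℝ) := by
  simp only [card_filter, Nat.cast_sum]
  exact sum_comm

/-- Markov's inequality for fibres: few elements of `A` have many bad partners. -/
theorem card_filter_fibre_mul_le {V : Type*} [DecidableEq V] (A : Finset V) (r : V → V → Prop)
    [∀ a b, Decidable (r a b)] (s : ℝ) :
    (#{a ∈ A | s < #{d ∈ A | r a d}} : ℝ) * s ≤ #{p ∈ A ×ˢ A | r p.1 p.2} := by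
  have h : (#{p ∈ A ×ˢ A | r p.1 p.2} : ℝ) = ∑ a ∈ A, (#{d ∈ A | r a d} : ℝ) := by
    simp only [card_filter, Nat.cast_sum]
    rw [sum_product]
  rw [h]
  calc (#{a ∈ A | s < #{d ∈ A | r a d}} : ℝ) * s
      = ∑ a ∈ A with s < #{d ∈ A | r a d}, s := by rw [sum_const, nsmul_eq_mul]
    _ ≤ ∑ a ∈ A with s < #{d ∈ A | r a d}, (#{d ∈ A | r a d} : ℝ) :=
        sum_le_sum fun a ha => (mem_filter.1 ha).2.le
    _ ≤ _ := sum_le_sum_of_subset_of_nonneg (filter_subset _ _) (fun _ _ _ => Nat.cast_nonneg _)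

/-- Dependent random choice: in a graph of density `α` there is a set `A₁` of relative size about
`α`, most of whose pairs have many common neighbours. -/
theorem dependent_random_choice {V : Type*} [DecidableEq V] (A : Finset V) (adj : V → V → Prop)
    [∀ a b, Decidable (adj a b)] (α : ℝ) (hα : 0 < α)
    (he : α * (#A : ℝ) ^ 2 = #{p ∈ A ×ˢ A | adj p.1 p.2}) (hA : A.Nonempty) :
    ∃ A₁ ⊆ A, ∃ A' ⊆ A₁, ∃ Q ⊆ A,
      α * #A / 4 ≤ #A₁ ∧ (#A₁ : ℝ) / 2 ≤ #A' ∧ α * #A / 4 ≤ #Q ∧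
      (∀ a ∈ A', ∀ b ∈ A', (#A₁ : ℝ) / 2 ≤
        #{d ∈ A₁ | α ^ 2 * #A / 512 ≤ #{x ∈ A | adj a x ∧ adj d x} ∧
          α ^ 2 * #A / 512 ≤ #{x ∈ A | adj b x ∧ adj d x}}) ∧
      (∀ a ∈ A', ∀ b ∈ Q, α * #A₁ / 8 ≤
        #{d ∈ A₁ | adj d b ∧ α ^ 3 * #A / 2048 ≤ #{x ∈ A | adj a x ∧ adj d x}}) := by
  classical
  have hn : (0 : ℝ) < #A := by exact_mod_cast hA.card_pos
  set n : ℝ := ((#A : ℕ) : ℝ) with hn_def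
  let deg : V → ℝ := fun a => #{b ∈ A | adj a b}
  let codeg : V → V → ℝ := fun a d => #{x ∈ A | adj a x ∧ adj d x}
  have hdeg : ∑ a ∈ A, deg a = α * n ^ 2 := by
    rw [he]
    simp only [deg, card_filter, Nat.cast_sum]
    rw [sum_product]
  -- Vertices of low degree meet at most half of the edges; restricting to L gives every vertex of
  -- A₁ the degree needed for the size of Q.
  let L := A.filter fun a => α * n / 2 ≤ deg a
  have hLA : L ⊆ A := filter_subset _ _
  have hLdeg : α * n ^ 2 / 2 ≤ ∑ a ∈ L, deg a := by
    have h1 := sum_filter_add_sum_filter_not A (fun a => α * n / 2 ≤ deg a) deg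
    have h2 : ∑ a ∈ A with ¬ (α * n / 2 ≤ deg a), deg a ≤ n * (α * n / 2) := by
      calc ∑ a ∈ A with ¬ (α * n / 2 ≤ deg a), deg a
          ≤ ∑ a ∈ A with ¬ (α * n / 2 ≤ deg a), (α * n / 2) :=
            sum_le_sum fun a ha => (not_le.1 (mem_filter.1 ha).2).le
        _ ≤ ∑ a ∈ A, (α * n / 2) := sum_le_sum_of_subset_of_nonneg (filter_subset _ _)
            (fun _ _ _ => by positivity)
        _ = n * (α * n / 2) := by rw [sum_const, nsmul_eq_mul]
    change _ ≤ ∑ a ∈ A with α * n / 2 ≤ deg a, deg a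
    have h3 : n * (α * n / 2) = α * n ^ 2 / 2 := by ring
    linarith
  let N : V → Finset V := fun c => L.filter fun a => adj a c
  have hNsum : ∑ c ∈ A, (#(N c) : ℝ) = ∑ a ∈ L, deg a :=
    (sum_card_filter_comm L A adj).symm
  have hNsq : α ^ 2 * n ^ 3 / 4 ≤ ∑ c ∈ A, (#(N c) : ℝ) ^ 2 := by
    have h1 := sq_sum_le_card_mul_sum_sq (s := A) (f := fun c => (#(N c) : ℝ))
    rw [hNsum] at h1
    have h2 : (α * n ^ 2 / 2) ^ 2 ≤ (∑ a ∈ L, deg a) ^ 2 := by gcongr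
    have h3 : n * (α ^ 2 * n ^ 3 / 4) ≤ n * ∑ c ∈ A, (#(N c) : ℝ) ^ 2 := by
      calc n * (α ^ 2 * n ^ 3 / 4) = (α * n ^ 2 / 2) ^ 2 := by ring
        _ ≤ _ := h2.trans h1
    exact le_of_mul_le_mul_left h3 hn
  let bad : ℝ → V → ℝ := fun s c => #{p ∈ N c ×ˢ N c | codeg p.1 p.2 < s}
  -- A pair of codegree below s lies in the neighbourhood N c for fewer than s choices of c.
  have hbad : ∀ s : ℝ, 0 ≤ s → ∑ c ∈ A, bad s c ≤ n ^ 2 * s := by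
    intro s hs
    have h1 : ∀ c, bad s c = #{p ∈ (L ×ˢ L).filter (fun p => codeg p.1 p.2 < s) |
        adj p.1 c ∧ adj p.2 c} := by
      intro c
      simp only [bad]
      congr 2
      ext p
      simp only [N, mem_filter, mem_product]
      tauto
    simp only [h1]
    rw [← sum_card_filter_comm ((L ×ˢ L).filter (fun p => codeg p.1 p.2 < s)) A
      (fun p c => adj p.1 c ∧ adj p.2 c)]
    calc ∑ p ∈ (L ×ˢ L).filter (fun p => codeg p.1 p.2 < s), (#{c ∈ A | adj p.1 c ∧ adj p.2 c} : ℝ)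
        ≤ ∑ p ∈ (L ×ˢ L).filter (fun p => codeg p.1 p.2 < s), s :=
          sum_le_sum fun p hp => (mem_filter.1 hp).2.le
      _ ≤ ∑ p ∈ A ×ˢ A, s := sum_le_sum_of_subset_of_nonneg
          ((filter_subset _ _).trans (product_subset_product hLA hLA)) (fun _ _ _ => hs)
      _ = n ^ 2 * s := by
          rw [sum_const, nsmul_eq_mul, card_product]; push_cast; rw [← hn_def]; ring
  set s₀ : ℝ := α ^ 2 * n / 512 with hs₀
  set s₁ : ℝ := α ^ 3 * n / 2048 with hs₁
  -- The weights 32 and 128/α make each penalty sum to at most α²n³/16, half of what the second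
  -- moment α²n³/4 can spare. A single c then controls the size of N c and both kinds of bad pairs.
  obtain ⟨c, hc, hcN⟩ : ∃ c ∈ A, α ^ 2 * n ^ 2 / 8 ≤
      (#(N c) : ℝ) ^ 2 - 32 * bad s₀ c - 128 / α * bad s₁ c := by
    apply exists_le_of_sum_le hA
    rw [sum_sub_distrib, sum_sub_distrib, ← mul_sum, ← mul_sum, sum_const, nsmul_eq_mul]
    have h0 := hbad s₀ (by positivity)
    have h1 := mul_le_mul_of_nonneg_left (hbad s₁ (by positivity))
      (show (0 : ℝ) ≤ 128 / α by positivity)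
    have e1 : 128 / α * (n ^ 2 * s₁) = α ^ 2 * n ^ 3 / 16 := by
      rw [hs₁]; field_simp; ring
    have e0 : 32 * (n ^ 2 * s₀) = α ^ 2 * n ^ 3 / 16 := by
      rw [hs₀]; ring
    rw [e1] at h1
    have e2 : n * (α ^ 2 * n ^ 2 / 8) = α ^ 2 * n ^ 3 / 8 := by ring
    rw [← hn_def, e2]
    linarith
  have hb0 : 0 ≤ bad s₀ c := Nat.cast_nonneg _
  have hb1 : 0 ≤ bad s₁ c := Nat.cast_nonneg _
  have hb1' : 0 ≤ 128 / α * bad s₁ c := by positivity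
  set A₁ := N c with hA₁
  set m : ℝ := ((#A₁ : ℕ) : ℝ) with hm
  have hm0 : 0 ≤ m := Nat.cast_nonneg _
  have hsq := sq_nonneg (α * n)
  rw [← mul_pow] at hcN
  have hA₁size : α * n / 4 ≤ m := by
    refine le_of_sq_le_sq ?_ hm0
    rw [div_pow]
    linarith
  have hmpos : 0 < m := lt_of_lt_of_le (by positivity) hA₁size
  have hbad0 : bad s₀ c ≤ m ^ 2 / 32 := by linarith
  have hbad1 : bad s₁ c ≤ α * m ^ 2 / 128 := by
    have : 128 / α * bad s₁ c ≤ m ^ 2 := by linarith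
    rw [div_mul_eq_mul_div, div_le_iff₀ hα] at this
    linarith
  -- Two codegree thresholds are needed: s₀ for paths of length four inside A', and the smaller s₁
  -- for paths of length three to Q, where only a fraction α of A₁ is adjacent to the endpoint.
  let U₀ := A₁.filter fun a => m / 8 < #{d ∈ A₁ | codeg a d < s₀}
  let U₁ := A₁.filter fun a => α * m / 16 < #{d ∈ A₁ | codeg a d < s₁}
  have hU₀ : (#U₀ : ℝ) ≤ m / 4 := by
    have := (card_filter_fibre_mul_le A₁ (fun a d => codeg a d < s₀) (m / 8)).trans hbad0
    have h2 : (#U₀ : ℝ) * (m / 8) ≤ m / 4 * (m / 8) := by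
      refine this.trans (le_of_eq (by ring))
    exact le_of_mul_le_mul_right h2 (by positivity)
  have hU₁ : (#U₁ : ℝ) ≤ m / 8 := by
    have := (card_filter_fibre_mul_le A₁ (fun a d => codeg a d < s₁) (α * m / 16)).trans hbad1
    have h2 : (#U₁ : ℝ) * (α * m / 16) ≤ m / 8 * (α * m / 16) := by
      refine this.trans (le_of_eq (by ring))
    exact le_of_mul_le_mul_right h2 (by positivity)
  let A' := A₁ \ (U₀ ∪ U₁)
  have hA' : m / 2 ≤ #A' := by
    have h1 : #A₁ ≤ #(U₀ ∪ U₁) + #A' := by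
      have : #A₁ ≤ #A' + #(U₀ ∪ U₁) := card_le_card_sdiff_add_card
      omega
    have h2 := card_union_le U₀ U₁
    have h3 : (m : ℝ) ≤ #U₀ + #U₁ + #A' := by
      rw [hm]; exact_mod_cast h1.trans (Nat.add_le_add_right h2 _)
    linarith
  let Q := A.filter fun b => α * m / 4 ≤ #{d ∈ A₁ | adj d b}
  have hA₁L : A₁ ⊆ L := filter_subset _ _
  have hQ : α * n / 4 ≤ #Q := by
    have h1 : α * n / 2 * m ≤ ∑ b ∈ A, (#{d ∈ A₁ | adj d b} : ℝ) := by
      rw [← sum_card_filter_comm A₁ A adj]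
      calc α * n / 2 * m = ∑ a ∈ A₁, α * n / 2 := by rw [sum_const, nsmul_eq_mul]; ring
        _ ≤ ∑ a ∈ A₁, deg a := sum_le_sum fun a ha => (mem_filter.1 (hA₁L ha)).2
    have h2 := sum_filter_add_sum_filter_not A (fun b => α * m / 4 ≤ #{d ∈ A₁ | adj d b})
      (fun b => (#{d ∈ A₁ | adj d b} : ℝ))
    have h3 : ∑ b ∈ A with ¬ (α * m / 4 ≤ #{d ∈ A₁ | adj d b}), (#{d ∈ A₁ | adj d b} : ℝ)
        ≤ n * (α * m / 4) := by
      calc _ ≤ ∑ b ∈ A with ¬ (α * m / 4 ≤ #{d ∈ A₁ | adj d b}), (α * m / 4) :=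
            sum_le_sum fun a ha => (not_le.1 (mem_filter.1 ha).2).le
        _ ≤ ∑ b ∈ A, (α * m / 4) := sum_le_sum_of_subset_of_nonneg (filter_subset _ _)
            (fun _ _ _ => by positivity)
        _ = _ := by rw [sum_const, nsmul_eq_mul]
    have h4 : ∑ b ∈ Q, (#{d ∈ A₁ | adj d b} : ℝ) ≤ #Q * m := by
      calc _ ≤ ∑ b ∈ Q, m := sum_le_sum fun b _ => by
            rw [hm]; exact_mod_cast card_le_card (filter_subset _ _)
        _ = _ := by rw [sum_const, nsmul_eq_mul]
    have h5 : α * n / 4 * m ≤ #Q * m := by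
      change ∑ b ∈ Q, (#{d ∈ A₁ | adj d b} : ℝ) + _ = _ at h2
      linarith
    exact le_of_mul_le_mul_right h5 hmpos
  refine ⟨A₁, hA₁L.trans hLA, A', sdiff_subset, Q, filter_subset _ _, hA₁size, hA', hQ, ?_, ?_⟩
  · have good : ∀ a ∈ A', (#{d ∈ A₁ | codeg a d < s₀} : ℝ) ≤ m / 8 := by
      intro a ha
      rw [mem_sdiff, mem_union, not_or] at ha
      by_contra! h
      exact ha.2.1 (mem_filter.2 ⟨ha.1, h⟩)
    intro a ha b hb
    have hsub : A₁ ⊆ (({d ∈ A₁ | codeg a d < s₀} ∪ {d ∈ A₁ | codeg b d < s₀}) ∪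
        {d ∈ A₁ | s₀ ≤ codeg a d ∧ s₀ ≤ codeg b d} : Finset V) := by
      intro d hd
      simp only [mem_union, mem_filter, hd, true_and]
      by_cases h1 : codeg a d < s₀
      · exact Or.inl (Or.inl h1)
      by_cases h2 : codeg b d < s₀
      · exact Or.inl (Or.inr h2)
      exact Or.inr ⟨not_lt.1 h1, not_lt.1 h2⟩
    have h1 := (card_le_card hsub).trans
      ((card_union_le _ _).trans (Nat.add_le_add_right (card_union_le _ _) _))
    have h2 : m ≤ #{d ∈ A₁ | codeg a d < s₀} + #{d ∈ A₁ | codeg b d < s₀} +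
        #{d ∈ A₁ | s₀ ≤ codeg a d ∧ s₀ ≤ codeg b d} := by
      rw [hm]; exact_mod_cast h1
    have := good a ha
    have := good b hb
    change m / 2 ≤ #{d ∈ A₁ | s₀ ≤ codeg a d ∧ s₀ ≤ codeg b d}
    linarith
  · intro a ha b hb
    have hga : (#{d ∈ A₁ | codeg a d < s₁} : ℝ) ≤ α * m / 16 := by
      rw [mem_sdiff, mem_union, not_or] at ha
      by_contra! h
      exact ha.2.2 (mem_filter.2 ⟨ha.1, h⟩)
    have hgb := (mem_filter.1 hb).2
    have hsub : ({d ∈ A₁ | adj d b} : Finset V) ⊆ ({d ∈ A₁ | codeg a d < s₁} ∪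
        {d ∈ A₁ | adj d b ∧ s₁ ≤ codeg a d} : Finset V) := by
      intro d hd
      rw [mem_filter] at hd
      simp only [mem_union, mem_filter, hd, true_and]
      exact lt_or_ge _ _
    have h1 := (card_le_card hsub).trans (card_union_le _ _)
    have h2 : (#{d ∈ A₁ | adj d b} : ℝ) ≤ #{d ∈ A₁ | codeg a d < s₁} +
        #{d ∈ A₁ | adj d b ∧ s₁ ≤ codeg a d} := by exact_mod_cast h1
    change α * m / 8 ≤ #{d ∈ A₁ | adj d b ∧ s₁ ≤ codeg a d}
    have : 0 < α * m := by positivity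
    linarith

/-! ### The Balog–Szemerédi–Gowers theorem -/

theorem card_mul_le_of_fibres {S T : Type*} [DecidableEq S] (s : Finset S) (t : Finset T)
    (φ : T → S) (c : ℝ) (h : ∀ z ∈ s, c ≤ #{τ ∈ t | φ τ = z}) : (#s : ℝ) * c ≤ #t := by
  calc (#s : ℝ) * c = ∑ z ∈ s, c := by rw [sum_const, nsmul_eq_mul]
    _ ≤ ∑ z ∈ s, (#{τ ∈ t | φ τ = z} : ℝ) := sum_le_sum h
    _ ≤ #t := by
        norm_cast
        rw [sum_card_fiberwise_eq_card_filter]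
        exact card_filter_le _ _

variable {G : Type*} [AddCommGroup G] [DecidableEq G]

/-- The number of representations of `d` as a difference of two elements of `A`. -/
def diffRep (A : Finset G) (d : G) : ℕ := #{p ∈ A ×ˢ A | p.1 - p.2 = d}

/-- Along a path a, x, d, y, b the difference a - b is a signed sum of four elements of P, in as
many ways as there are paths; along a path from A' to Q three elements suffice. -/
theorem balog_szemeredi_gowers_aux (A P : Finset G) (adj : G → G → Prop)
    [∀ a b, Decidable (adj a b)] (hadj : ∀ a ∈ A, ∀ b ∈ A, adj a b → a - b ∈ P)
    (α : ℝ) (hα : 0 < α) (he : α * (#A : ℝ) ^ 2 = #{p ∈ A ×ˢ A | adj p.1 p.2})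
    (hA : A.Nonempty) :
    ∃ A' ⊆ A, α * #A / 8 ≤ #A' ∧
      #(A' - A') * (α ^ 5 * (#A : ℝ) ^ 3) ≤ 2 ^ 21 * (#P : ℝ) ^ 4 ∧
      #(2 • A' - 2 • A') * (α * #A) ^ 3 * (α ^ 5 * (#A : ℝ) ^ 2) ^ 4 ≤
        2 ^ 70 * (#P : ℝ) ^ 12 := by
  obtain ⟨A₁, hA₁A, A', hA'A₁, Q, hQA, hA₁, hA', hQ, hpair, hpath⟩ :=
    dependent_random_choice A adj α hα he hA
  have hn : (0 : ℝ) < #A := by exact_mod_cast hA.card_pos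
  set n : ℝ := ((#A : ℕ) : ℝ) with hn_def
  set m : ℝ := ((#A₁ : ℕ) : ℝ) with hm_def
  have hm : 0 < m := lt_of_lt_of_le (by positivity) hA₁
  have hA'A : A' ⊆ A := hA'A₁.trans hA₁A
  have hdiff : #(A' - A') * (m / 2 * (α ^ 2 * n / 512) ^ 2) ≤ (#P : ℝ) ^ 4 := by
    have := card_mul_le_of_fibres (A' - A') ((P ×ˢ P) ×ˢ (P ×ˢ P))
      (fun τ => τ.1.1 - τ.1.2 + (τ.2.1 - τ.2.2)) (m / 2 * (α ^ 2 * n / 512) ^ 2) ?_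
    · refine this.trans (le_of_eq ?_)
      rw [card_product, card_product]; push_cast; ring
    intro z hz
    obtain ⟨a, ha, b, hb, rfl⟩ := mem_sub.1 hz
    let I : Finset (Σ _ : G, G × G) := ({d ∈ A₁ | α ^ 2 * n / 512 ≤ #{x ∈ A | adj a x ∧ adj d x} ∧
          α ^ 2 * n / 512 ≤ #{x ∈ A | adj b x ∧ adj d x}} : Finset G).sigma
            fun d => ({x ∈ A | adj a x ∧ adj d x} : Finset G) ×ˢ {x ∈ A | adj b x ∧ adj d x}
    have hI : m / 2 * (α ^ 2 * n / 512) ^ 2 ≤ #I := by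
      rw [card_sigma]
      push_cast
      calc m / 2 * (α ^ 2 * n / 512) ^ 2 ≤ _ * (α ^ 2 * n / 512) ^ 2 :=
            mul_le_mul_of_nonneg_right (hpair a ha b hb) (by positivity)
        _ = ∑ d ∈ A₁ with (α ^ 2 * n / 512 ≤ #{x ∈ A | adj a x ∧ adj d x} ∧
          α ^ 2 * n / 512 ≤ #{x ∈ A | adj b x ∧ adj d x}), (α ^ 2 * n / 512) ^ 2 := by
            rw [sum_const, nsmul_eq_mul]
        _ ≤ _ := by
            refine sum_le_sum fun d hd => ?_
            have h := (mem_filter.1 hd).2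
            rw [card_product, sq]
            push_cast
            exact mul_le_mul h.1 h.2 (by positivity) (Nat.cast_nonneg _)
    refine hI.trans ?_
    norm_cast
    refine card_le_card_of_injOn
      (fun i => ((a - i.2.1, i.1 - i.2.1), (i.1 - i.2.2, b - i.2.2))) ?_ ?_
    · rintro ⟨d, x, y⟩ hi
      simp only [I, coe_sigma, Set.mem_sigma_iff, mem_coe, mem_filter, mem_product] at hi
      obtain ⟨⟨hd, -⟩, ⟨hx, hax, hdx⟩, hy, hby, hdy⟩ := hi
      have hdA := hA₁A hd
      have haA := hA'A ha
      have hbA := hA'A hb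
      simp only [mem_coe, mem_filter, mem_product]
      refine ⟨⟨⟨hadj _ haA _ hx hax, hadj _ hdA _ hx hdx⟩, hadj _ hdA _ hy hdy,
        hadj _ hbA _ hy hby⟩, by abel⟩
    · rintro ⟨d, x, y⟩ _ ⟨d', x', y'⟩ _ h
      simp only [Prod.mk.injEq] at h
      obtain ⟨⟨h1, h2⟩, h3, h4⟩ := h
      have hx : x = x' := sub_right_injective h1
      subst hx
      have hy : y = y' := sub_right_injective h4
      subst hy
      have hd : d = d' := sub_left_injective h2
      subst hd
      rfl
  have hdiffQ : #(Q - A') * (α * m / 8 * (α ^ 3 * n / 2048)) ≤ (#P : ℝ) ^ 3 := by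
    have := card_mul_le_of_fibres (Q - A') ((P ×ˢ P) ×ˢ P)
      (fun τ => τ.1.2 - τ.1.1 - τ.2) (α * m / 8 * (α ^ 3 * n / 2048)) ?_
    · refine this.trans (le_of_eq ?_)
      rw [card_product, card_product]; push_cast; ring
    intro z hz
    obtain ⟨b, hb, a, ha, rfl⟩ := mem_sub.1 hz
    let I : Finset (Σ _ : G, G) := ({d ∈ A₁ | adj d b ∧ α ^ 3 * n / 2048 ≤
        #{x ∈ A | adj a x ∧ adj d x}} : Finset G).sigma
            fun d => ({x ∈ A | adj a x ∧ adj d x} : Finset G)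
    have hI : α * m / 8 * (α ^ 3 * n / 2048) ≤ #I := by
      rw [card_sigma]
      push_cast
      calc α * m / 8 * (α ^ 3 * n / 2048) ≤ _ * (α ^ 3 * n / 2048) :=
            mul_le_mul_of_nonneg_right (hpath a ha b hb) (by positivity)
        _ = ∑ d ∈ A₁ with (adj d b ∧ α ^ 3 * n / 2048 ≤
              #{x ∈ A | adj a x ∧ adj d x}), (α ^ 3 * n / 2048) := by
            rw [sum_const, nsmul_eq_mul]
        _ ≤ _ := sum_le_sum fun d hd => (mem_filter.1 hd).2.2
    refine hI.trans ?_
    norm_cast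
    refine card_le_card_of_injOn (fun i => ((a - i.2, i.1 - i.2), i.1 - b)) ?_ ?_
    · rintro ⟨d, x⟩ hi
      simp only [I, coe_sigma, Set.mem_sigma_iff, mem_coe, mem_filter] at hi
      obtain ⟨⟨hd, hdb, -⟩, hx, hax, hdx⟩ := hi
      have hdA := hA₁A hd
      simp only [mem_coe, mem_filter, mem_product]
      refine ⟨⟨⟨hadj _ (hA'A ha) _ hx hax, hadj _ hdA _ hx hdx⟩, hadj _ hdA _ (hQA hb) hdb⟩,
        by abel⟩
    · rintro ⟨d, x⟩ _ ⟨d', x'⟩ _ h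
      simp only [Prod.mk.injEq] at h
      obtain ⟨⟨h1, h2⟩, h3⟩ := h
      have hx : x = x' := sub_right_injective h1
      subst hx
      have hd : d = d' := sub_left_injective h2
      subst hd
      rfl
  refine ⟨A', hA'A, by linarith, ?_, ?_⟩
  · calc #(A' - A') * (α ^ 5 * n ^ 3) = #(A' - A') * (2 ^ 21 *
          (α * n / 4 / 2 * (α ^ 2 * n / 512) ^ 2)) := by ring
      _ ≤ #(A' - A') * (2 ^ 21 * (m / 2 * (α ^ 2 * n / 512) ^ 2)) := by gcongr
      _ = 2 ^ 21 * (#(A' - A') * (m / 2 * (α ^ 2 * n / 512) ^ 2)) := by ring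
      _ ≤ _ := by gcongr
  · have hQpos : (0 : ℝ) < #Q := lt_of_lt_of_le (by positivity) hQ
    have hQne : Q.Nonempty := card_pos.1 (by exact_mod_cast hQpos)
    -- Comparing A' with Q rather than with itself uses paths of length three: the fourth power of
    -- |Q - A'| costs |P|¹² where |A' - A'| would cost |P|¹⁶.
    have hPl := pluennecke_ruzsa_inequality_nsmul_sub_nsmul_sub hQne A' 2 2
    have hPl' : (#(2 • A' - 2 • A') : ℝ) * #Q ^ 3 ≤ (#(Q - A') : ℝ) ^ 4 := by
      have h1 : (#(2 • A' - 2 • A') : ℝ) ≤ ((#(Q - A') : ℝ) / #Q) ^ (2 + 2) * #Q := by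
        have : ((#(2 • A' - 2 • A') : ℚ≥0) : ℝ) ≤
            ((((#(Q - A') : ℚ≥0) / #Q) ^ (2 + 2) * #Q : ℚ≥0) : ℝ) := by exact_mod_cast hPl
        simpa using this
      calc (#(2 • A' - 2 • A') : ℝ) * #Q ^ 3
          ≤ (((#(Q - A') : ℝ) / #Q) ^ (2 + 2) * #Q) * #Q ^ 3 := by gcongr
        _ = _ := by
            have := hQpos.ne'
            generalize (#Q : ℝ) = u at *
            generalize (#(Q - A') : ℝ) = w at *
            rw [show 2 + 2 = 4 from rfl]
            field_simp
    have hD : #(Q - A') * (α ^ 5 * n ^ 2) ≤ 2 ^ 16 * (#P : ℝ) ^ 3 := by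
      calc #(Q - A') * (α ^ 5 * n ^ 2) = #(Q - A') * (2 ^ 16 *
            (α * (α * n / 4) / 8 * (α ^ 3 * n / 2048))) := by ring
        _ ≤ #(Q - A') * (2 ^ 16 * (α * m / 8 * (α ^ 3 * n / 2048))) := by gcongr
        _ = 2 ^ 16 * (#(Q - A') * (α * m / 8 * (α ^ 3 * n / 2048))) := by ring
        _ ≤ _ := by gcongr
    calc #(2 • A' - 2 • A') * (α * n) ^ 3 * (α ^ 5 * n ^ 2) ^ 4
        = #(2 • A' - 2 • A') * (64 * (α * n / 4) ^ 3) * (α ^ 5 * n ^ 2) ^ 4 := by ring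
      _ ≤ #(2 • A' - 2 • A') * (64 * (#Q : ℝ) ^ 3) * (α ^ 5 * n ^ 2) ^ 4 := by gcongr
      _ = 64 * (#(2 • A' - 2 • A') * (#Q : ℝ) ^ 3) * (α ^ 5 * n ^ 2) ^ 4 := by ring
      _ ≤ 64 * ((#(Q - A') : ℝ) ^ 4) * (α ^ 5 * n ^ 2) ^ 4 := by gcongr
      _ = 64 * (#(Q - A') * (α ^ 5 * n ^ 2)) ^ 4 := by ring
      _ ≤ 64 * (2 ^ 16 * (#P : ℝ) ^ 3) ^ 4 := by gcongr
      _ = _ := by ring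

/-- Here p counts popular differences, w edges, and t is the popularity threshold. Eliminating t
from pt ≤ w and E ≤ ℓtw gives pE ≤ ℓw². The resulting factor α² outweighs the negative powers of α
from path counting. -/
theorem popular_card_le {n E κ ℓ t w p α : ℝ} (hn : 0 < n) (hκ0 : 0 ≤ κ) (hℓ : 0 ≤ ℓ)
    (hp : 0 ≤ p) (hw0 : 0 ≤ w) (hκ : n ^ 3 ≤ κ * E) (hsum : E ≤ ℓ * (t * w)) (hpw : p * t ≤ w)
    (hw : w = α * n ^ 2) : p ≤ ℓ * κ * α ^ 2 * n := by
  have h1 : p * E ≤ ℓ * w ^ 2 := by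
    calc p * E ≤ p * (ℓ * (t * w)) := by gcongr
      _ = ℓ * (p * t) * w := by ring
      _ ≤ ℓ * w * w := by gcongr
      _ = _ := by ring
  have h2 : p * n ^ 3 ≤ (ℓ * κ * α ^ 2 * n) * n ^ 3 := by
    calc p * n ^ 3 ≤ p * (κ * E) := by gcongr
      _ = κ * (p * E) := by ring
      _ ≤ κ * (ℓ * w ^ 2) := by gcongr
      _ = _ := by rw [hw]; ring
  exact le_of_mul_le_mul_right h2 (by positivity)

theorem doubling_bounds_of_popular {n k p α D D₂ : ℝ} (hn : 0 < n) (hα : 0 < α)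
    (hp : 0 ≤ p) (hpk : p ≤ k * α ^ 2 * n) (h1 : D * (α ^ 5 * n ^ 3) ≤ 2 ^ 21 * p ^ 4)
    (h2 : D₂ * (α * n) ^ 3 * (α ^ 5 * n ^ 2) ^ 4 ≤ 2 ^ 70 * p ^ 12) :
    D ≤ 2 ^ 21 * k ^ 4 * α ^ 3 * n ∧ D₂ ≤ 2 ^ 70 * k ^ 12 * α * n := by
  constructor
  · have h3 : D * (α ^ 5 * n ^ 3) ≤ (2 ^ 21 * k ^ 4 * α ^ 3 * n) * (α ^ 5 * n ^ 3) := by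
      calc _ ≤ 2 ^ 21 * p ^ 4 := h1
        _ ≤ 2 ^ 21 * (k * α ^ 2 * n) ^ 4 := by gcongr
        _ = _ := by ring
    exact le_of_mul_le_mul_right h3 (by positivity)
  · have h3 : D₂ * ((α * n) ^ 3 * (α ^ 5 * n ^ 2) ^ 4) ≤
        (2 ^ 70 * k ^ 12 * α * n) * ((α * n) ^ 3 * (α ^ 5 * n ^ 2) ^ 4) := by
      calc _ = D₂ * (α * n) ^ 3 * (α ^ 5 * n ^ 2) ^ 4 := by ring
        _ ≤ 2 ^ 70 * p ^ 12 := h2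
        _ ≤ 2 ^ 70 * (k * α ^ 2 * n) ^ 12 := by gcongr
        _ = _ := by ring
    exact le_of_mul_le_mul_right h3 (by positivity)

/-- A Balog–Szemerédi–Gowers theorem with explicit dependence on the density `α` of the graph of
popular differences. -/
theorem balog_szemeredi_gowers (A : Finset G) (hA : A.Nonempty) (κ : ℝ)
    (hκ : (#A : ℝ) ^ 3 ≤ κ * ∑ p ∈ A ×ˢ A, (diffRep A (p.1 - p.2) : ℝ)) :
    ∃ α : ℝ, 0 < α ∧ ∃ A' ⊆ A, α * #A / 8 ≤ #A' ∧
      #(A' - A') ≤ 2 ^ 21 * ((1 + Real.log ((#A : ℝ) ^ 2)) * κ) ^ 4 * α ^ 3 * #A ∧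
      #(2 • A' - 2 • A') ≤
        2 ^ 70 * ((1 + Real.log ((#A : ℝ) ^ 2)) * κ) ^ 12 * α * #A := by
  have hn : (0 : ℝ) < #A := by exact_mod_cast hA.card_pos
  set n : ℝ := ((#A : ℕ) : ℝ) with hn_def
  set E : ℝ := ∑ p ∈ A ×ˢ A, (diffRep A (p.1 - p.2) : ℝ) with hE_def
  have hE0 : 0 ≤ E := sum_nonneg fun _ _ => Nat.cast_nonneg _
  have hκE : 0 < κ * E := lt_of_lt_of_le (by positivity) hκ
  have hE : 0 < E := by
    rcases hE0.lt_or_eq with h | h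
    · exact h
    · rw [← h, mul_zero] at hκE; exact absurd hκE (lt_irrefl _)
  have hκ0 : 0 < κ := pos_of_mul_pos_left hκE hE0
  obtain ⟨t, ht, hsum⟩ := exists_sum_le_log_mul (A ×ˢ A) (hA.product hA)
    (fun p => (diffRep A (p.1 - p.2) : ℝ)) hE
  rw [card_product] at hsum
  push_cast at hsum
  rw [← hn_def, ← sq, ← hE_def] at hsum
  set ℓ : ℝ := 1 + Real.log (n ^ 2) with hℓ
  let adj : G → G → Prop := fun a b => t ≤ diffRep A (a - b)
  classical
  set W : Finset (G × G) := {p ∈ A ×ˢ A | t ≤ (diffRep A (p.1 - p.2) : ℝ)} with hW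
  set P : Finset G := W.image fun p => p.1 - p.2 with hP
  -- All representations of a popular difference are edges, and there are at least t of them.
  have hPW : (#P : ℝ) * t ≤ #W := by
    refine card_mul_le_of_fibres P W (fun p => p.1 - p.2) t fun z hz => ?_
    obtain ⟨p, hp, rfl⟩ := mem_image.1 hz
    have hp' := (mem_filter.1 hp).2
    refine hp'.trans ?_
    rw [diffRep]
    norm_cast
    refine card_le_card fun r hr => ?_
    rw [mem_filter] at hr
    refine mem_filter.2 ⟨mem_filter.2 ⟨hr.1, ?_⟩, hr.2⟩
    rw [hr.2]; exact hp'
  have hℓ0 : 1 ≤ ℓ := by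
    have : (1 : ℝ) ≤ n := by rw [hn_def]; exact_mod_cast hA.card_pos
    have := Real.log_nonneg (show (1 : ℝ) ≤ n ^ 2 by nlinarith)
    linarith
  have hWpos : (0 : ℝ) < #W := by
    by_contra! h
    have : (#W : ℝ) = 0 := le_antisymm h (Nat.cast_nonneg _)
    rw [this] at hsum
    simp only [mul_zero] at hsum
    linarith
  have hP0 : (0 : ℝ) ≤ #P := Nat.cast_nonneg _
  set α : ℝ := #W / n ^ 2 with hα_def
  have hα : 0 < α := div_pos hWpos (pow_pos hn 2)
  have hWα : (#W : ℝ) = α * n ^ 2 := (div_mul_cancel₀ _ (pow_pos hn 2).ne').symm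
  have hPle := popular_card_le hn hκ0.le (zero_le_one.trans hℓ0) hP0 hWpos.le hκ hsum hPW hWα
  obtain ⟨A', hA', hsize, h1, h2⟩ := balog_szemeredi_gowers_aux A P adj
    (fun a ha b hb h => mem_image.2 ⟨(a, b), mem_filter.2 ⟨mem_product.2 ⟨ha, hb⟩, h⟩, rfl⟩)
    α hα hWα.symm hA
  exact ⟨α, hα, A', hA', hsize, doubling_bounds_of_popular hn hα hP0 hPle h1 h2⟩

/-! ### Ratio sets, covering by translates, and pivots -/

section SumProduct

variable {F : Type*} [Field F] [DecidableEq F]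

/-- The set of quotients of differences of elements of `D`. -/
def ratioSet (D : Finset F) : Set F :=
  {r | ∃ a ∈ D, ∃ b ∈ D, ∃ c ∈ D, ∃ d ∈ D, c ≠ d ∧ r * (c - d) = a - b}

/-- Some d in A - A is a difference w - x, with w in W and x in V, in at least |W||V|/|A - A| ways.
For such a pair aw - ad = ax ∈ B, so t = ad works. -/
theorem exists_dense_translate (A B W V : Finset F) (a : F) (hW : W ⊆ A) (hV : V ⊆ A)
    (hVB : ∀ x ∈ V, a * x ∈ B) (hA : A.Nonempty) :
    ∃ t : F, (#W : ℝ) * #V ≤ #{w ∈ W | a * w - t ∈ B} * #(A - A) := by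
  have hne : (A - A).Nonempty := hA.sub hA
  have hpos : (0 : ℝ) < #(A - A) := by exact_mod_cast hne.card_pos
  have hmaps : ∀ z ∈ W ×ˢ V, z.1 - z.2 ∈ A - A := fun z hz =>
    sub_mem_sub (hW (mem_product.1 hz).1) (hV (mem_product.1 hz).2)
  have hsum := card_eq_sum_card_fiberwise hmaps
  obtain ⟨d, -, hd⟩ : ∃ d ∈ A - A, (#W : ℝ) * #V / #(A - A) ≤
      #{z ∈ W ×ˢ V | z.1 - z.2 = d} := by
    apply exists_le_of_sum_le hne
    rw [sum_const, nsmul_eq_mul, mul_div_cancel₀ _ hpos.ne']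
    rw [card_product] at hsum
    exact_mod_cast hsum.le
  refine ⟨a * d, ?_⟩
  rw [div_le_iff₀ hpos] at hd
  refine hd.trans ?_
  gcongr
  refine card_le_card_of_injOn Prod.fst ?_ ?_
  · rintro ⟨w, c⟩ hz
    simp only [mem_coe, mem_filter, mem_product] at hz ⊢
    refine ⟨hz.1.1, ?_⟩
    rw [← hz.2, ← mul_sub, sub_sub_cancel]
    exact hVB c hz.1.2
  · rintro ⟨w, c⟩ hz ⟨w', c'⟩ hz' h
    simp only [mem_coe, mem_filter, mem_product] at hz hz' h
    have h1 := hz.2.trans hz'.2.symm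
    subst h
    rw [sub_right_injective h1]

/-- Greedy covering: half of `W` is covered by few translates. -/
theorem exists_half_covered (A B W : Finset F) (a : F) (p : ℝ) (hp : 0 < p) (hW : W ⊆ A)
    (h : ∀ V ⊆ A, ∃ t : F, p * #V ≤ #{w ∈ V | a * w - t ∈ B}) :
    ∃ W' ⊆ W, (#W : ℝ) / 2 ≤ #W' ∧ ∃ T : Finset F, (#T : ℝ) ≤ 2 / p ∧
      ∀ w ∈ W', ∃ t ∈ T, a * w - t ∈ B := by
  classical
  rcases W.eq_empty_or_nonempty with rfl | hWne
  · exact ⟨∅, subset_rfl, by simp, ∅, by simp; positivity, by simp⟩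
  have hWpos : (0 : ℝ) < #W := by exact_mod_cast hWne.card_pos
  let cov : Finset F → Finset F := fun T => {w ∈ W | ∃ t ∈ T, a * w - t ∈ B}
  let good : Finset F → Prop := fun T => (#T : ℝ) * (p * (#W / 2)) ≤ #(cov T)
  have hex : ∃ n : ℕ, ∃ T, good T ∧ #(cov T) = n := ⟨_, ∅, by simp [good], rfl⟩
  have hbd : ∀ n : ℕ, (∃ T, good T ∧ #(cov T) = n) → n ≤ #W := by
    rintro n ⟨T, -, rfl⟩
    exact card_le_card (filter_subset _ _)
  -- Take a family of maximal coverage among those whose translates cover p|W|/2 points each on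
  -- average. If it missed more than half of W, a dense translate for the remainder could be added.
  obtain ⟨T, hT, hTmax⟩ : ∃ T, good T ∧ ∀ T', good T' → #(cov T') ≤ #(cov T) := by
    obtain ⟨T, hT, hTn⟩ := Nat.findGreatest_spec (P := fun n => ∃ T, good T ∧ #(cov T) = n)
      (hbd _ hex.choose_spec) hex.choose_spec
    refine ⟨T, hT, fun T' hT' => ?_⟩
    rw [hTn]
    exact Nat.le_findGreatest (hbd _ ⟨T', hT', rfl⟩) ⟨T', hT', rfl⟩
  have hcovW : (#(cov T) : ℝ) ≤ #W := by exact_mod_cast card_le_card (filter_subset _ _)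
  refine ⟨cov T, filter_subset _ _, ?_, T, ?_, fun w hw => (mem_filter.1 hw).2⟩
  · by_contra! hlt
    set R := W \ cov T with hR
    have hRcard : (#W : ℝ) / 2 < #R := by
      have h1 : #W ≤ #R + #(cov T) := card_le_card_sdiff_add_card
      have h2 : (#W : ℝ) ≤ #R + #(cov T) := by exact_mod_cast h1
      linarith
    obtain ⟨t, ht⟩ := h R (sdiff_subset.trans hW)
    have hnew : p * (#W / 2) ≤ #{w ∈ R | a * w - t ∈ B} :=
      le_trans (by gcongr) ht
    have hdisj : Disjoint (cov T) {w ∈ R | a * w - t ∈ B} := by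
      rw [disjoint_left]
      intro w hw hw'
      exact (mem_sdiff.1 (mem_filter.1 hw').1).2 hw
    have hsub : cov T ∪ {w ∈ R | a * w - t ∈ B} ⊆ cov (insert t T) := by
      intro w hw
      rcases mem_union.1 hw with hw | hw
      · obtain ⟨h1, s, hs, h2⟩ := mem_filter.1 hw
        exact mem_filter.2 ⟨h1, s, mem_insert_of_mem hs, h2⟩
      · obtain ⟨h1, h2⟩ := mem_filter.1 hw
        exact mem_filter.2 ⟨(mem_sdiff.1 h1).1, t, mem_insert_self _ _, h2⟩
    have hcard := card_le_card hsub
    rw [card_union_of_disjoint hdisj] at hcard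
    have hcard' : (#(cov T) : ℝ) + #{w ∈ R | a * w - t ∈ B} ≤ #(cov (insert t T)) := by
      exact_mod_cast hcard
    have hgood : good (insert t T) := by
      have h1 : (#(insert t T) : ℝ) ≤ #T + 1 := by exact_mod_cast card_insert_le _ _
      have h2 : (#(insert t T) : ℝ) * (p * (#W / 2)) ≤ (#T + 1) * (p * (#W / 2)) := by
        have : (0 : ℝ) ≤ p * (#W / 2) := mul_nonneg hp.le (by linarith)
        exact mul_le_mul_of_nonneg_right h1 this
      have h3 : (#T : ℝ) * (p * (#W / 2)) ≤ #(cov T) := hT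
      change (#(insert t T) : ℝ) * (p * (#W / 2)) ≤ #(cov (insert t T))
      linarith
    have h1 := hTmax _ hgood
    have h2 : (#(cov (insert t T)) : ℝ) ≤ #(cov T) := by exact_mod_cast h1
    have h3 : 0 < p * (#W / 2 : ℝ) := mul_pos hp (by linarith)
    linarith
  · have h1 : (#T : ℝ) * (p * (#W / 2)) ≤ #(cov T) := hT
    rw [le_div_iff₀ hp]
    have h2 : (#T * p) * (#W / 2 : ℝ) ≤ 2 * (#W / 2 : ℝ) := by
      calc (#T * p) * (#W / 2 : ℝ) = (#T : ℝ) * (p * (#W / 2)) := by ring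
        _ ≤ #W := h1.trans hcovW
        _ = _ := by ring
    exact le_of_mul_le_mul_right h2 (by linarith)

/-- Regroup (c - d)w₁ + (a - b)w₂ as (cw₁ + aw₂) - (dw₁ + bw₂). Each of the four products lies in B
up to a translate, leaving an element of 2B - 2B. -/
theorem card_image_le_of_covered (B W₁ W₂ Ta Tb Tc Td : Finset F) (a b c d : F)
    (hc : ∀ w ∈ W₁, ∃ t ∈ Tc, c * w - t ∈ B) (hd : ∀ w ∈ W₁, ∃ t ∈ Td, d * w - t ∈ B)
    (ha : ∀ w ∈ W₂, ∃ t ∈ Ta, a * w - t ∈ B) (hb : ∀ w ∈ W₂, ∃ t ∈ Tb, b * w - t ∈ B) :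
    #((W₁ ×ˢ W₂).image fun w => (c - d) * w.1 + (a - b) * w.2) ≤
      #Tc * #Td * (#Ta * #Tb) * #(2 • B - 2 • B) := by
  calc _ ≤ #((((Tc ×ˢ Td) ×ˢ (Ta ×ˢ Tb)) ×ˢ (2 • B - 2 • B)).image fun z =>
        z.1.1.1 - z.1.1.2 + (z.1.2.1 - z.1.2.2) + z.2) := ?_
    _ ≤ _ := card_image_le
    _ = _ := by simp only [card_product]
  refine card_le_card fun z hz => ?_
  obtain ⟨⟨w₁, w₂⟩, hw, rfl⟩ := mem_image.1 hz
  obtain ⟨hw₁, hw₂⟩ := mem_product.1 hw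
  obtain ⟨tc, htc, h1⟩ := hc _ hw₁
  obtain ⟨td, htd, h2⟩ := hd _ hw₁
  obtain ⟨ta, hta, h3⟩ := ha _ hw₂
  obtain ⟨tb, htb, h4⟩ := hb _ hw₂
  refine mem_image.2 ⟨(((tc, td), (ta, tb)), ((c * w₁ - tc) + (a * w₂ - ta)) -
    ((d * w₁ - td) + (b * w₂ - tb))), ?_, by ring⟩
  simp only [mem_product]
  refine ⟨⟨⟨htc, htd⟩, hta, htb⟩, sub_mem_sub ?_ ?_⟩
  · rw [two_nsmul]; exact add_mem_add h1 h3
  · rw [two_nsmul]; exact add_mem_add h2 h4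

/-- A collision x + ξy = x' + ξy' with y ≠ y' exhibits ξ as (x' - x)/(y - y'). -/
theorem injOn_of_not_mem_ratioSet (D : Finset F) (ξ : F) (hξ : ξ ∉ ratioSet D) :
    Set.InjOn (fun z : F × F => z.1 + ξ * z.2) ((D ×ˢ D : Finset (F × F)) : Set (F × F)) := by
  rintro ⟨x, y⟩ hz ⟨x', y'⟩ hz' h
  simp only [mem_coe, mem_product] at hz hz' h
  have hy : y = y' := by
    by_contra hne
    refine hξ ⟨x', hz'.1, x, hz.1, y, hz.2, y', hz'.2, hne, ?_⟩
    linear_combination h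
  subst hy
  simpa using h

variable {A B D : Finset F} {p N : ℝ}

/-- Since r + 1 is not a ratio, (x, y) ↦ x - y - ry is injective on D × D. Plünnecke for the
summands -D₂ and -rD₂ bounds its image through D₀ - D₂ ⊆ A - A and D₀ - rD₂; the latter, scaled by c
- d, is covered by translates of 2B - 2B. -/
theorem pivot_add_one (hA : A.Nonempty) (hDA : D ⊆ A) (hp : 0 < p) (hN : 0 < N)
    (hgood : ∀ a ∈ D, N ≤ #{x ∈ D | a * x ∈ B})
    (htrans : ∀ a ∈ D, ∀ V ⊆ A, ∃ t : F, p * #V ≤ #{w ∈ V | a * w - t ∈ B})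
    (r : F) (hr : r ∈ ratioSet D) (hr1 : r + 1 ∉ ratioSet D) :
    p * N * (N / 2) ^ 2 ≤ 4 * (#(A - A) * (2 / p * #(2 • B - 2 • B))) := by
  classical
  obtain ⟨a, ha, b, hb, c, hc, d, hd, hcd, hrel⟩ := hr
  have hcd0 : c - d ≠ 0 := sub_ne_zero.2 hcd
  set Dc : Finset F := {x ∈ D | c * x ∈ B} with hDc
  set Da : Finset F := {x ∈ D | a * x ∈ B} with hDa
  have hDcD : Dc ⊆ D := filter_subset _ _
  have hDaD : Da ⊆ D := filter_subset _ _
  -- |D₀| enters squared, so D₀ is covered by 2/p translates at the cost of a factor 2; D₂ enters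
  -- once and is cut down to a single dense translate.
  obtain ⟨D₀, hD₀, hD₀c, Td, hTd, hcov⟩ := exists_half_covered A B Dc d p hp
    (hDcD.trans hDA) (htrans d hd)
  obtain ⟨t, ht⟩ := htrans b hb Da (hDaD.trans hDA)
  set D₂ : Finset F := {w ∈ Da | b * w - t ∈ B} with hD₂
  have hD₂a : D₂ ⊆ Da := filter_subset _ _
  have hD₂c : p * N ≤ #D₂ := le_trans (by gcongr; exact hgood a ha) ht
  have hD₀N : N / 2 ≤ #D₀ := le_trans (by gcongr; exact hgood c hc) hD₀c
  have hD₀pos : (0 : ℝ) < #D₀ := lt_of_lt_of_le (by linarith) hD₀N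
  have hD₂pos : (0 : ℝ) < #D₂ := lt_of_lt_of_le (mul_pos hp hN) hD₂c
  have hD₀ne : D₀.Nonempty := card_pos.1 (by exact_mod_cast hD₀pos)
  have hD₂ne : D₂.Nonempty := card_pos.1 (by exact_mod_cast hD₂pos)
  have hD₀D := hD₀.trans hDcD
  have hD₂D := hD₂a.trans hDaD
  obtain ⟨X, hX, hXne, hP⟩ := pluennecke_two_summands D₀ (-D₂) (D₂.image fun y => -(r * y))
    hD₀ne hD₂ne.neg (hD₂ne.image _)
  have hXpos : (0 : ℝ) < #X := by exact_mod_cast hXne.card_pos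
  have h1 : #(D₀ + -D₂) ≤ #(A - A) := by
    rw [← sub_eq_add_neg]
    exact card_le_card (sub_subset_sub (hD₀D.trans hDA) (hD₂D.trans hDA))
  have h2 : (#(D₀ + D₂.image fun y => -(r * y)) : ℝ) ≤ 2 / p * #(2 • B - 2 • B) := by
    have hle := card_image_le_of_covered B D₀ D₂ {t} {0} {0} Td b a c d
      (fun w hw => ⟨0, mem_singleton_self _, by
        rw [sub_zero]; exact (mem_filter.1 (hD₀ hw)).2⟩) hcov
      (fun w hw => ⟨t, mem_singleton_self _, (mem_filter.1 hw).2⟩)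
      (fun w hw => ⟨0, mem_singleton_self _, by
        rw [sub_zero]; exact (mem_filter.1 (hD₂a hw)).2⟩)
    have hle2 : #(D₀ + D₂.image fun y => -(r * y)) ≤ #Td * #(2 • B - 2 • B) := by
      refine le_trans ?_ (hle.trans (by simp))
      rw [← card_image_of_injective (D₀ + D₂.image fun y => -(r * y))
        (mul_right_injective₀ hcd0)]
      refine card_le_card fun z hz => ?_
      obtain ⟨s, hs, rfl⟩ := mem_image.1 hz
      obtain ⟨x, hx, y', hy', rfl⟩ := mem_add.1 hs
      obtain ⟨y, hy, rfl⟩ := mem_image.1 hy'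
      refine mem_image.2 ⟨(x, y), mem_product.2 ⟨hx, hy⟩, ?_⟩
      simp only
      linear_combination y * hrel
    calc (#(D₀ + D₂.image fun y => -(r * y)) : ℝ) ≤ #Td * #(2 • B - 2 • B) := by
          exact_mod_cast hle2
      _ ≤ _ := by gcongr
  have h3 : #X * #D₂ ≤ #(X + -D₂ + D₂.image fun y => -(r * y)) := by
    rw [← card_product]
    refine card_le_card_of_injOn (fun z => z.1 + -z.2 + -(r * z.2)) ?_ ?_
    · rintro ⟨x, y⟩ hz
      obtain ⟨hx, hy⟩ := mem_product.1 (mem_coe.1 hz)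
      exact add_mem_add (add_mem_add hx (neg_mem_neg hy)) (mem_image_of_mem _ hy)
    · rintro ⟨x, y⟩ hz ⟨x', y'⟩ hz' h
      simp only [mem_coe, mem_product] at hz hz' h
      have hy : y = y' := by
        by_contra hne
        refine hr1 ⟨x, hD₀D (hX hz.1), x', hD₀D (hX hz'.1), y, hD₂D hz.2, y', hD₂D hz'.2, hne, ?_⟩
        linear_combination -h
      subst hy
      simpa using h
  have h4 : (#X : ℝ) * #D₂ * #D₀ ^ 2 ≤ 4 * (#(A - A) * (2 / p * #(2 • B - 2 • B))) * #X := by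
    calc (#X : ℝ) * #D₂ * #D₀ ^ 2
        ≤ (#(X + -D₂ + D₂.image fun y => -(r * y)) : ℝ) * (#D₀ : ℝ) ^ 2 := by
          gcongr; exact_mod_cast h3
      _ ≤ 4 * ((#(D₀ + -D₂) : ℝ) * (#(D₀ + D₂.image fun y => -(r * y)) : ℝ)) * (#X : ℝ) := by
          exact_mod_cast hP
      _ ≤ _ := by gcongr
  have h5 : (#D₂ : ℝ) * #D₀ ^ 2 ≤ 4 * (#(A - A) * (2 / p * #(2 • B - 2 • B))) := by
    refine le_of_mul_le_mul_right ?_ hXpos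
    calc (#D₂ : ℝ) * #D₀ ^ 2 * #X = (#X : ℝ) * #D₂ * #D₀ ^ 2 := by ring
      _ ≤ _ := h4
  refine le_trans ?_ h5
  have : 0 ≤ N / 2 := by linarith
  gcongr

/-- Now (x, y) ↦ x + (e/x₀)ry is injective on D × D. With w = ey/x₀ it becomes, after scaling by c -
d, the map (c - d)x + (a - b)w. Three dense translates put all products in single translates of B,
so the image lies in one translate of 2B - 2B. -/
theorem pivot_mul (x₀ : F) (hx₀ : x₀ ≠ 0) (hDA : D ⊆ A) (hp : 0 < p) (hN : 0 < N)
    (hBA : ∀ z ∈ B, z / x₀ ∈ A)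
    (hgood : ∀ a ∈ D, N ≤ #{x ∈ D | a * x ∈ B})
    (htrans : ∀ a ∈ D, ∀ V ⊆ A, ∃ t : F, p * #V ≤ #{w ∈ V | a * w - t ∈ B})
    (r e : F) (he : e ∈ D) (hr : r ∈ ratioSet D) (hr1 : e / x₀ * r ∉ ratioSet D)
    (he0 : e ≠ 0) :
    (p * N) * (p * (p * N)) ≤ #(2 • B - 2 • B) := by
  classical
  obtain ⟨a, ha, b, hb, c, hc, d, hd, hcd, hrel⟩ := hr
  have hcd0 : c - d ≠ 0 := sub_ne_zero.2 hcd
  set Dc : Finset F := {x ∈ D | c * x ∈ B} with hDc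
  have hDcD : Dc ⊆ D := filter_subset _ _
  obtain ⟨td, htd⟩ := htrans d hd Dc (hDcD.trans hDA)
  set D₁ : Finset F := {w ∈ Dc | d * w - td ∈ B} with hD₁
  -- Requiring ex ∈ B keeps the dilate by e/x₀ inside A, where dense translates are available.
  set W : Finset F := ({x ∈ D | e * x ∈ B} : Finset F).image fun x => e * x / x₀ with hW
  have hWA : W ⊆ A := by
    intro w hw
    obtain ⟨x, hx, rfl⟩ := mem_image.1 hw
    exact hBA _ (mem_filter.1 hx).2
  have hex : e / x₀ ≠ 0 := div_ne_zero he0 hx₀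
  have hWc : N ≤ #W := by
    rw [hW, card_image_of_injective]
    · exact hgood e he
    · intro x y h
      have h' : e / x₀ * x = e / x₀ * y := by
        simpa only [div_mul_eq_mul_div] using h
      exact mul_left_cancel₀ hex h'
  obtain ⟨ta, hta⟩ := htrans a ha W hWA
  set W₁ : Finset F := {w ∈ W | a * w - ta ∈ B} with hW₁
  obtain ⟨tb, htb⟩ := htrans b hb W₁ ((filter_subset _ _).trans hWA)
  set W₂ : Finset F := {w ∈ W₁ | b * w - tb ∈ B} with hW₂
  have hD₁c : p * N ≤ #D₁ := le_trans (by gcongr; exact hgood c hc) htd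
  have hW₁c : p * N ≤ #W₁ := le_trans (by gcongr) hta
  have hW₂c : p * (p * N) ≤ #W₂ := le_trans (by gcongr) htb
  have hle := card_image_le_of_covered B D₁ W₂ {ta} {tb} {0} {td} a b c d
      (fun w hw => ⟨0, mem_singleton_self _, by
        rw [sub_zero]; exact (mem_filter.1 (mem_filter.1 hw).1).2⟩)
      (fun w hw => ⟨td, mem_singleton_self _, (mem_filter.1 hw).2⟩)
      (fun w hw => ⟨ta, mem_singleton_self _, (mem_filter.1 (mem_filter.1 hw).1).2⟩)
      (fun w hw => ⟨tb, mem_singleton_self _, (mem_filter.1 hw).2⟩)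
  rw [card_image_of_injOn] at hle
  · rw [card_product] at hle
    have hle' : (#D₁ : ℝ) * #W₂ ≤ #(2 • B - 2 • B) := by
      have : #D₁ * #W₂ ≤ #(2 • B - 2 • B) := by simpa using hle
      exact_mod_cast this
    refine le_trans ?_ hle'
    gcongr
  · rintro ⟨x, w⟩ hz ⟨x', w'⟩ hz' h
    simp only [mem_coe, mem_product] at hz hz' h
    obtain ⟨y, hy, hyw⟩ := mem_image.1 (mem_filter.1 (mem_filter.1 hz.2).1).1
    obtain ⟨y', hy', hyw'⟩ := mem_image.1 (mem_filter.1 (mem_filter.1 hz'.2).1).1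
    have hxD : x ∈ D := hDcD (mem_filter.1 hz.1).1
    have hxD' : x' ∈ D := hDcD (mem_filter.1 hz'.1).1
    have h1 : x + e / x₀ * r * y = x' + e / x₀ * r * y' := by
      have e1 : e / x₀ * y = w := by rw [← hyw]; ring
      have e2 : e / x₀ * y' = w' := by rw [← hyw']; ring
      refine mul_left_cancel₀ hcd0 ?_
      linear_combination h + (w * hrel - w' * hrel) + (c - d) * r * (e1 - e2)
    have hinj := injOn_of_not_mem_ratioSet D _ hr1
    have := @hinj (x, y)
      (mem_coe.2 (mem_product.2 ⟨hxD, (mem_filter.1 hy).1⟩)) (x', y')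
      (mem_coe.2 (mem_product.2 ⟨hxD', (mem_filter.1 hy').1⟩)) h1
    simp only [Prod.mk.injEq] at this ⊢
    refine ⟨this.1, ?_⟩
    rw [← hyw, ← hyw', this.2]

end SumProduct

/-! ### Ratio sets that are subfields -/

section SumProduct

variable {F : Type*} [Field F] [Fintype F]

theorem inv_eq_pow_card_sub_two {u : F} (hu : u ≠ 0) : u⁻¹ = u ^ (Fintype.card F - 1 - 1) := by
  have h1 : 1 < Fintype.card F := Fintype.one_lt_card
  have h2 := FiniteField.pow_card_sub_one_eq_one u hu
  refine mul_left_cancel₀ hu ?_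
  rw [mul_inv_cancel₀ hu, ← pow_succ', Nat.sub_add_cancel (by omega), h2]

/-- A ratio set which is closed under adding `1` and under multiplication by the (normalized)
elements of `D` is a subfield. -/
theorem exists_subfield_eq_ratioSet (D : Finset F) (x₀ : F) (hx₀ : x₀ ≠ 0) (h0 : (0 : F) ∉ D)
    (hD : D.Nontrivial) (hadd : ∀ r ∈ ratioSet D, r + 1 ∈ ratioSet D)
    (hmul : ∀ e ∈ D, ∀ r ∈ ratioSet D, e / x₀ * r ∈ ratioSet D) :
    ∃ G : Subfield F, (G : Set F) = ratioSet D ∧ ∀ e ∈ D, e / x₀ ∈ G := by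
  set R := ratioSet D with hR
  obtain ⟨c₀, hc₀, d₀, hd₀, hcd₀⟩ := hD
  have hR0 : (0 : F) ∈ R := ⟨c₀, hc₀, c₀, hc₀, c₀, hc₀, d₀, hd₀, hcd₀, by simp⟩
  -- H is the group of translations preserving R, and G below is its ring of multipliers. Finiteness
  -- supplies negatives as multiples and inverses as powers.
  let H : Set F := {g | ∀ r ∈ R, r + g ∈ R}
  have hH0 : (0 : F) ∈ H := fun r hr => by simpa using hr
  have hH1 : (1 : F) ∈ H := hadd
  have hHadd : ∀ g ∈ H, ∀ g' ∈ H, g + g' ∈ H := fun g hg g' hg' r hr => by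
    rw [← add_assoc]; exact hg' _ (hg _ hr)
  have hHnsmul : ∀ g ∈ H, ∀ n : ℕ, n • g ∈ H := by
    intro g hg n
    induction n with
    | zero => simpa using hH0
    | succ n ih => rw [succ_nsmul]; exact hHadd _ ih _ hg
  have hHneg : ∀ g ∈ H, -g ∈ H := by
    intro g hg
    have h1 : 1 ≤ Fintype.card F := Fintype.card_pos
    have h2 : -g = (Fintype.card F - 1) • g := by
      rw [neg_eq_iff_add_eq_zero, ← succ_nsmul', Nat.sub_add_cancel h1, card_nsmul_eq_zero]
    rw [h2]
    exact hHnsmul g hg _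
  have hHR : H ⊆ R := fun g hg => by simpa using hg 0 hR0
  have hpow : ∀ (g : F), (∀ h ∈ H, g * h ∈ H) → ∀ n : ℕ, ∀ h ∈ H, g ^ n * h ∈ H := by
    intro g hg n
    induction n with
    | zero => intro h hh; simpa using hh
    | succ n ih => intro h hh; rw [pow_succ, mul_assoc]; exact ih _ (hg h hh)
  let G : Subfield F :=
    { carrier := {g | ∀ h ∈ H, g * h ∈ H}
      mul_mem' := fun {a b} ha hb h hh => by rw [mul_assoc]; exact ha _ (hb _ hh)
      one_mem' := fun h hh => by rwa [one_mul]
      add_mem' := fun {a b} ha hb h hh => by rw [add_mul]; exact hHadd _ (ha _ hh) _ (hb _ hh)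
      zero_mem' := fun h hh => by rw [zero_mul]; exact hH0
      neg_mem' := fun {a} ha h hh => by rw [neg_mul]; exact hHneg _ (ha _ hh)
      inv_mem' := fun a ha => by
        rcases eq_or_ne a 0 with rfl | hne
        · intro h hh; rw [inv_zero, zero_mul]; exact hH0
        · intro h hh; rw [inv_eq_pow_card_sub_two hne]; exact hpow a ha _ h hh }
  have hΛ : ∀ e ∈ D, e / x₀ ∈ G := by
    intro e he g hg r hr
    have hu : e / x₀ ≠ 0 := div_ne_zero (fun h => h0 (h ▸ he)) hx₀
    -- Multiplication by e/x₀ has finite order, so its inverse also preserves R; conjugating a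
    -- translation of R by it gives another translation of R.
    have hinv : (e / x₀)⁻¹ * r ∈ R := by
      have : ∀ n : ℕ, (e / x₀) ^ n * r ∈ R := by
        intro n
        induction n with
        | zero => simpa using hr
        | succ n ih => rw [pow_succ', mul_assoc]; exact hmul e he _ ih
      rw [inv_eq_pow_card_sub_two hu]
      exact this _
    have := hmul e he _ (hg _ hinv)
    rwa [mul_add, mul_inv_cancel_left₀ hu] at this
  -- G ⊆ H ⊆ R because 1 ∈ H and 0 ∈ R; conversely a ratio of differences of D is unchanged by
  -- dividing D by x₀, and D/x₀ ⊆ G.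
  refine ⟨G, Set.Subset.antisymm (fun g hg => hHR ?_) ?_, hΛ⟩
  · have := hg 1 hH1
    rwa [mul_one] at this
  · rintro r ⟨a, ha, b, hb, c, hc, d, hd, hcd, hrel⟩
    have h1 : r = (a / x₀ - b / x₀) / (c / x₀ - d / x₀) := by
      rw [← sub_div, ← sub_div, div_div_div_cancel_right₀ hx₀, eq_div_iff (sub_ne_zero.2 hcd), hrel]
    rw [h1]
    exact G.div_mem (G.sub_mem (hΛ a ha) (hΛ b hb)) (G.sub_mem (hΛ c hc) (hΛ d hd))

/-- On average over `ξ`, the energy between `D` and `ξ D` is close to minimal. -/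
theorem exists_small_energy {F : Type*} [Field F] [DecidableEq F] (D S : Finset F) (hS : S.Nonempty) :
    ∃ ξ ∈ S, (#{z ∈ (D ×ˢ D) ×ˢ (D ×ˢ D) | z.1.1 + ξ * z.1.2 = z.2.1 + ξ * z.2.2} : ℝ) * #S ≤
      (#D : ℝ) ^ 2 * #S + (#D : ℝ) ^ 4 := by
  have hSpos : (0 : ℝ) < #S := by exact_mod_cast hS.card_pos
  set Q := (D ×ˢ D) ×ˢ (D ×ˢ D) with hQ
  have hdiag : ∀ ξ : F, (#{z ∈ Q | z.1.1 + ξ * z.1.2 = z.2.1 + ξ * z.2.2 ∧ z.1.2 = z.2.2} : ℝ)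
      ≤ (#D : ℝ) ^ 2 := by
    intro ξ
    have : #{z ∈ Q | z.1.1 + ξ * z.1.2 = z.2.1 + ξ * z.2.2 ∧ z.1.2 = z.2.2} ≤ #(D ×ˢ D) := by
      refine card_le_card_of_injOn Prod.fst ?_ ?_
      · intro z hz
        exact mem_coe.2 (mem_product.1 (mem_filter.1 (mem_coe.1 hz)).1).1
      · rintro ⟨⟨x, y⟩, x', y'⟩ hz ⟨⟨w, u⟩, w', u'⟩ hz' h
        have h1 := (mem_filter.1 (mem_coe.1 hz)).2
        have h2 := (mem_filter.1 (mem_coe.1 hz')).2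
        simp only [Prod.mk.injEq] at h h1 h2 ⊢
        obtain ⟨rfl, rfl⟩ := h
        obtain ⟨h3, rfl⟩ := h1
        obtain ⟨h4, rfl⟩ := h2
        exact ⟨⟨rfl, rfl⟩, (add_right_cancel (h3.symm.trans h4)), rfl⟩
    rw [card_product, ← sq] at this
    exact_mod_cast this
  have hoff : ∑ ξ ∈ S, (#{z ∈ Q | z.1.1 + ξ * z.1.2 = z.2.1 + ξ * z.2.2 ∧ z.1.2 ≠ z.2.2} : ℝ)
      ≤ (#D : ℝ) ^ 4 := by
    -- A quadruple whose second coordinates differ satisfies the equation for at most one ξ.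
    rw [sum_card_filter_comm S Q
      (fun ξ z => z.1.1 + ξ * z.1.2 = z.2.1 + ξ * z.2.2 ∧ z.1.2 ≠ z.2.2)]
    calc _ ≤ ∑ z ∈ Q, (1 : ℝ) := by
          refine sum_le_sum fun z _ => ?_
          norm_cast
          refine card_le_one.2 fun ξ hξ ξ' hξ' => ?_
          obtain ⟨-, h1, h2⟩ := mem_filter.1 hξ
          obtain ⟨-, h3, -⟩ := mem_filter.1 hξ'
          refine mul_right_cancel₀ (sub_ne_zero.2 h2) ?_
          linear_combination h1 - h3
      _ = (#D : ℝ) ^ 4 := by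
          rw [sum_const, nsmul_eq_mul, hQ, card_product, card_product]; push_cast; ring
  obtain ⟨ξ, hξ, h⟩ : ∃ ξ ∈ S,
      (#{z ∈ Q | z.1.1 + ξ * z.1.2 = z.2.1 + ξ * z.2.2 ∧ z.1.2 ≠ z.2.2} : ℝ) ≤
        (#D : ℝ) ^ 4 / #S := by
    apply exists_le_of_sum_le hS
    rw [sum_const, nsmul_eq_mul, mul_div_cancel₀ _ hSpos.ne']
    exact hoff
  refine ⟨ξ, hξ, ?_⟩
  rw [le_div_iff₀ hSpos] at h
  have hsplit : (#{z ∈ Q | z.1.1 + ξ * z.1.2 = z.2.1 + ξ * z.2.2} : ℝ) =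
      #{z ∈ Q | z.1.1 + ξ * z.1.2 = z.2.1 + ξ * z.2.2 ∧ z.1.2 = z.2.2} +
      #{z ∈ Q | z.1.1 + ξ * z.1.2 = z.2.1 + ξ * z.2.2 ∧ z.1.2 ≠ z.2.2} := by
    have := card_filter_add_card_filter_not
      (s := {z ∈ Q | z.1.1 + ξ * z.1.2 = z.2.1 + ξ * z.2.2}) (fun z => z.1.2 = z.2.2)
    rw [filter_filter, filter_filter] at this
    exact_mod_cast this.symm
  rw [hsplit, add_mul]
  have := mul_le_mul_of_nonneg_right (hdiag ξ) hSpos.le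
  linarith

theorem card_sq_le_card_image_mul {S T : Type*} [DecidableEq T] (s : Finset S) (f : S → T) :
    (#s : ℝ) ^ 2 ≤ #(s.image f) * #{z ∈ s ×ˢ s | f z.1 = f z.2} := by
  classical
  have h1 : (#s : ℝ) = ∑ i ∈ s.image f, (#{x ∈ s | f x = i} : ℝ) := by
    have := card_eq_sum_card_fiberwise (f := f) (s := s) (t := s.image f)
      (fun x hx => mem_image_of_mem f hx)
    exact_mod_cast this
  have h2 : (#{z ∈ s ×ˢ s | f z.1 = f z.2} : ℝ) =
      ∑ i ∈ s.image f, (#{x ∈ s | f x = i} : ℝ) ^ 2 := by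
    have h3 := card_eq_sum_card_fiberwise (f := fun z : S × S => f z.1)
      (s := {z ∈ s ×ˢ s | f z.1 = f z.2}) (t := s.image f)
      (fun z hz => mem_image_of_mem f (mem_product.1 (mem_filter.1 hz).1).1)
    rw [h3]
    push_cast
    refine sum_congr rfl fun i _ => ?_
    rw [sq, ← Nat.cast_mul, ← card_product]
    congr 2
    ext ⟨x, y⟩
    simp only [mem_filter, mem_product]
    constructor
    · rintro ⟨⟨⟨hx, hy⟩, h⟩, rfl⟩
      exact ⟨⟨hx, rfl⟩, hy, h.symm⟩
    · rintro ⟨⟨hx, rfl⟩, hy, h⟩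
      exact ⟨⟨⟨hx, hy⟩, h.symm⟩, rfl⟩
  rw [h2]
  conv_lhs => rw [h1]
  exact sq_sum_le_card_mul_sum_sq

variable [DecidableEq F] {A B D : Finset F} {p : ℝ}

theorem field_case_arith {M s g u E : ℝ} (hM : 0 < M) (hs1 : 1 ≤ s) (hgs : s + 1 = g)
    (hu0 : 0 ≤ u) (h1 : (M / 4 * (M / 4)) ^ 2 ≤ 2 ^ 4 * u * E)
    (hE : E * s ≤ M ^ 2 * s + M ^ 4) :
    M ^ 2 * g ≤ 2 ^ 12 * u * (g + 2 * M ^ 2) := by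
  -- Replacing the number s of nonzero field elements by g = s + 1 costs one extra E, which is at
  -- most M² + M⁴ because s ≥ 1.
  have h2 : E * g ≤ M ^ 2 * g + 2 * M ^ 4 := by
    have h3 : E * g = E * s + E := by rw [← hgs]; ring
    have h4 : E ≤ M ^ 2 + M ^ 4 := by
      have : (E - M ^ 2) * s ≤ M ^ 4 := by linarith
      rcases le_or_gt E (M ^ 2) with h | h
      · have : 0 ≤ M ^ 4 := by positivity
        linarith
      · have : (E - M ^ 2) * 1 ≤ (E - M ^ 2) * s :=
          mul_le_mul_of_nonneg_left hs1 (by linarith)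
        linarith
    rw [h3, ← hgs]
    linarith
  have hg0 : 0 < g := by linarith
  have h5 : M ^ 2 * (M ^ 2 * g) ≤ M ^ 2 * (2 ^ 12 * u * (g + 2 * M ^ 2)) := by
    calc M ^ 2 * (M ^ 2 * g) = 2 ^ 8 * (M / 4 * (M / 4)) ^ 2 * g := by ring
      _ ≤ 2 ^ 8 * (2 ^ 4 * u * E) * g := by gcongr
      _ = 2 ^ 12 * u * (E * g) := by ring
      _ ≤ 2 ^ 12 * u * (M ^ 2 * g + 2 * M ^ 4) := by gcongr
      _ = _ := by ring
  exact le_of_mul_le_mul_left h5 (by positivity)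

/-- Some nonzero ξ in G has near-minimal energy between D and ξD. Being a ratio (a - b)/(c - d), it
allows W₁ + ξW₂, with W₁ and W₂ each a quarter of D, to be covered by (2/p)⁴ translates of 2B - 2B;
Cauchy–Schwarz compares the two. -/
theorem field_case (hDA : D ⊆ A) (hp : 0 < p) (hDne : D.Nonempty)
    (htrans : ∀ a ∈ D, ∀ V ⊆ A, ∃ t : F, p * #V ≤ #{w ∈ V | a * w - t ∈ B})
    (G : Subfield F) (hG : (G : Set F) = ratioSet D) :
    (#D : ℝ) ^ 2 * Nat.card G ≤
      2 ^ 12 * (#(2 • B - 2 • B) / p ^ 4) * (Nat.card G + 2 * (#D : ℝ) ^ 2) := by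
  classical
  have hM : (0 : ℝ) < #D := by exact_mod_cast hDne.card_pos
  set S : Finset F := {ξ | ξ ∈ G ∧ ξ ≠ 0} with hS
  have hScard : #S + 1 = Nat.card G := by
    have h1 : Nat.card G = #({ξ | ξ ∈ G} : Finset F) := by
      rw [Nat.card_eq_fintype_card, Fintype.card_subtype]
    have h2 : ({ξ | ξ ∈ G} : Finset F) = insert 0 S := by
      ext ξ
      simp only [hS, mem_filter, mem_univ, true_and, mem_insert]
      constructor
      · intro h; by_cases h0 : ξ = 0
        · exact Or.inl h0
        · exact Or.inr ⟨h, h0⟩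
      · rintro (rfl | h)
        · exact G.zero_mem
        · exact h.1
    rw [h1, h2, card_insert_of_notMem (by simp [hS])]
  have hS1 : (1 : F) ∈ S := by simp [hS, G.one_mem]
  obtain ⟨ξ, hξ, hE⟩ := exists_small_energy D S ⟨1, hS1⟩
  have hSpos : 0 < #S := card_pos.2 ⟨1, hS1⟩
  set E : ℝ := ((#{z ∈ (D ×ˢ D) ×ˢ (D ×ˢ D) | z.1.1 + ξ * z.1.2 = z.2.1 + ξ * z.2.2} : ℕ) : ℝ)
    with hEdef
  have hξG : ξ ∈ ratioSet D := by
    rw [← hG]; exact (mem_filter.1 hξ).2.1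
  obtain ⟨a, ha, b, hb, c, hc, d, hd, hcd, hrel⟩ := hξG
  have hcd0 : c - d ≠ 0 := sub_ne_zero.2 hcd
  have cover : ∀ a ∈ D, ∀ b ∈ D, ∃ W ⊆ D, (#D : ℝ) / 4 ≤ #W ∧
      (∃ T : Finset F, (#T : ℝ) ≤ 2 / p ∧ ∀ w ∈ W, ∃ t ∈ T, a * w - t ∈ B) ∧
      (∃ T : Finset F, (#T : ℝ) ≤ 2 / p ∧ ∀ w ∈ W, ∃ t ∈ T, b * w - t ∈ B) := by
    intro a ha b hb
    obtain ⟨W, hW, hWc, T, hT, hcov⟩ := exists_half_covered A B D a p hp hDA (htrans a ha)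
    obtain ⟨W', hW', hWc', T', hT', hcov'⟩ :=
      exists_half_covered A B W b p hp (hW.trans hDA) (htrans b hb)
    exact ⟨W', hW'.trans hW, by linarith, ⟨T, hT, fun w hw => hcov w (hW' hw)⟩, T', hT', hcov'⟩
  obtain ⟨W₁, hW₁, hW₁c, ⟨Tc, hTc, hcovc⟩, Td, hTd, hcovd⟩ := cover c hc d hd
  obtain ⟨W₂, hW₂, hW₂c, ⟨Ta, hTa, hcova⟩, Tb, hTb, hcovb⟩ := cover a ha b hb
  have hle := card_image_le_of_covered B W₁ W₂ Ta Tb Tc Td a b c d hcovc hcovd hcova hcovb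
  have hU : (#((W₁ ×ˢ W₂).image fun w => w.1 + ξ * w.2) : ℝ) ≤
      2 ^ 4 * (#(2 • B - 2 • B) / p ^ 4) := by
    have h1 : #((W₁ ×ˢ W₂).image fun w => w.1 + ξ * w.2) =
        #((W₁ ×ˢ W₂).image fun w => (c - d) * w.1 + (a - b) * w.2) := by
      rw [← card_image_of_injective _ (mul_right_injective₀ hcd0), image_image]
      congr 2
      ext w
      simp only [Function.comp]
      linear_combination w.2 * hrel
    rw [h1]
    calc (#((W₁ ×ˢ W₂).image fun w => (c - d) * w.1 + (a - b) * w.2) : ℝ)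
        ≤ (#Tc : ℝ) * #Td * (#Ta * #Tb) * #(2 • B - 2 • B) := by exact_mod_cast hle
      _ ≤ (2 / p) * (2 / p) * ((2 / p) * (2 / p)) * #(2 • B - 2 • B) := by gcongr
      _ = _ := by
        generalize (#(2 • B - 2 • B) : ℝ) = u
        field_simp
  have hCS := card_sq_le_card_image_mul (W₁ ×ˢ W₂) (fun w => w.1 + ξ * w.2)
  have hE' : (#{z ∈ (W₁ ×ˢ W₂) ×ˢ (W₁ ×ˢ W₂) | z.1.1 + ξ * z.1.2 = z.2.1 + ξ * z.2.2} : ℝ) ≤ E := by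
    rw [hEdef]
    norm_cast
    exact card_le_card (filter_subset_filter _ (product_subset_product
      (product_subset_product hW₁ hW₂) (product_subset_product hW₁ hW₂)))
  rw [card_product] at hCS
  push_cast at hCS
  have hgs : (#S : ℝ) + 1 = Nat.card G := by exact_mod_cast hScard
  have hs1 : (1 : ℝ) ≤ #S := by exact_mod_cast hSpos
  refine field_case_arith hM hs1 hgs (div_nonneg (Nat.cast_nonneg _) (pow_pos hp 4).le) ?_ hE
  calc ((#D : ℝ) / 4 * (#D / 4)) ^ 2 ≤ ((#W₁ : ℝ) * #W₂) ^ 2 := by gcongr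
    _ ≤ _ := hCS
    _ ≤ _ := mul_le_mul hU hE' (Nat.cast_nonneg _) (Nat.cast_nonneg _ |>.trans hU)

end SumProduct

/-! ### The sum-product theorem -/

section SumProduct

/-- The number of representations of `ξ` as a quotient of two elements of `A`. -/
def quotRep {F : Type*} [Field F] [DecidableEq F] (A : Finset F) (ξ : F) : ℕ :=
  #{p ∈ A ×ˢ A | p.1 = ξ * p.2}

theorem card_nsmul_sub_image_mul {F : Type*} [Field F] [DecidableEq F] (A : Finset F) (x₀ : F)
    (hx₀ : x₀ ≠ 0) :
    #(2 • A.image (x₀ * ·) - 2 • A.image (x₀ * ·)) = #(2 • A - 2 • A) := by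
  have h : ∀ S : Finset F, S.image (x₀ * ·) = S.image (AddMonoidHom.mulLeft x₀) := fun _ => rfl
  have h2 : ∀ S : Finset F, S.image (x₀ * ·) - S.image (x₀ * ·) = (S - S).image (x₀ * ·) :=
    fun S => (image_image₂_distrib fun a b => mul_sub x₀ a b).symm
  rw [h, ← image_nsmul, ← h, h2]
  exact card_image_of_injective _ (mul_right_injective₀ hx₀)

/-- A set of dilates on which `xy ∈ x₀ A` has large minimal degree, together with a lower bound
for its size. -/
theorem exists_regular_subset {F : Type*} [Field F] [DecidableEq F] (A B : Finset F)
    (he : 0 < #{z ∈ A ×ˢ A | z.1 * z.2 ∈ B}) :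
    ∃ D ⊆ A, D.Nonempty ∧ ∃ N : ℝ, 4 * N * #D ≤ (#D : ℝ) ^ 2 ∧
      (∀ a ∈ D, N ≤ #{x ∈ D | a * x ∈ B}) ∧
      (#{z ∈ A ×ˢ A | z.1 * z.2 ∈ B} : ℝ) ^ 2 ≤ 16 * N ^ 2 * #D * #A ∧ 0 < N := by
  classical
  let e : Finset F → ℝ := fun D => #{z ∈ D ×ˢ D | z.1 * z.2 ∈ B}
  have hA : A.Nonempty := by
    obtain ⟨z, hz⟩ := card_pos.1 he
    exact ⟨z.1, (mem_product.1 (mem_filter.1 hz).1).1⟩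
  have hApos : (0 : ℝ) < #A := by exact_mod_cast hA.card_pos
  -- Maximising e(D)²/|D| forces every degree to be at least e(D)/(4|D|): deleting an element of
  -- smaller degree would increase the quotient.
  obtain ⟨D, hD, hmax⟩ := exists_max_image (A.powerset.erase ∅) (fun D => e D ^ 2 / #D)
    ⟨A, by simp [hA.ne_empty]⟩
  simp only [mem_erase, mem_powerset, ne_eq, and_imp] at hD hmax
  have hDne : D.Nonempty := nonempty_iff_ne_empty.2 hD.1
  have hDpos : (0 : ℝ) < #D := by exact_mod_cast hDne.card_pos
  have heA : (0 : ℝ) < e A := Nat.cast_pos.2 he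
  have h1 : e A ^ 2 / #A ≤ e D ^ 2 / #D := hmax A hA.ne_empty subset_rfl
  have heD : 0 < e D := by
    have h0 : 0 < e D ^ 2 / #D := lt_of_lt_of_le (div_pos (pow_pos heA 2) hApos) h1
    rcases (Nat.cast_nonneg _ : (0 : ℝ) ≤ e D).lt_or_eq with h | h
    · exact h
    · change (0 : ℝ) = e D at h
      rw [← h] at h0; simp at h0
  have heDle : e D ≤ (#D : ℝ) ^ 2 := by
    have : #{z ∈ D ×ˢ D | z.1 * z.2 ∈ B} ≤ #D ^ 2 := by
      rw [sq, ← card_product]; exact card_filter_le _ _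
    have h2 : e D ≤ ((#D ^ 2 : ℕ) : ℝ) := Nat.cast_le.2 this
    rwa [Nat.cast_pow] at h2
  refine ⟨D, hD.2, hDne, e D / (4 * #D), ?_, ?_, ?_, by positivity⟩
  · rw [show 4 * (e D / (4 * #D)) * #D = e D by field_simp]
    exact heDle
  · intro a ha
    by_contra! hlt
    set dg : ℝ := ((#{x ∈ D | a * x ∈ B} : ℕ) : ℝ) with hdg
    have hdg0 : 0 ≤ dg := Nat.cast_nonneg _
    rw [lt_div_iff₀ (by positivity)] at hlt
    have hsplit : e D ≤ e (D.erase a) + 2 * dg := by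
      have hsub : ({z ∈ D ×ˢ D | z.1 * z.2 ∈ B} : Finset (F × F)) ⊆
          ({z ∈ D.erase a ×ˢ D.erase a | z.1 * z.2 ∈ B} ∪
            ({x ∈ D | a * x ∈ B} : Finset F).image fun x => (a, x)) ∪
            ({x ∈ D | a * x ∈ B} : Finset F).image fun x => (x, a) := by
        rintro ⟨x, y⟩ hz
        simp only [mem_filter, mem_product] at hz
        obtain ⟨⟨hx, hy⟩, hxy⟩ := hz
        by_cases hxa : x = a
        · subst hxa
          exact mem_union_left _ (mem_union_right _
            (mem_image.2 ⟨y, mem_filter.2 ⟨hy, hxy⟩, rfl⟩))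
        by_cases hya : y = a
        · subst hya
          exact mem_union_right _
            (mem_image.2 ⟨x, mem_filter.2 ⟨hx, by rwa [mul_comm]⟩, rfl⟩)
        · exact mem_union_left _ (mem_union_left _ (mem_filter.2
            ⟨mem_product.2 ⟨mem_erase.2 ⟨hxa, hx⟩, mem_erase.2 ⟨hya, hy⟩⟩, hxy⟩))
      have h2 := (card_le_card hsub).trans ((card_union_le _ _).trans
        (Nat.add_le_add (card_union_le _ _) le_rfl))
      have h3 : #(({x ∈ D | a * x ∈ B} : Finset F).image fun x => (a, x)) ≤
        #{x ∈ D | a * x ∈ B} := card_image_le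
      have h4 : #(({x ∈ D | a * x ∈ B} : Finset F).image fun x => (x, a)) ≤
        #{x ∈ D | a * x ∈ B} := card_image_le
      have h5 : #{z ∈ D ×ˢ D | z.1 * z.2 ∈ B} ≤
        #{z ∈ D.erase a ×ˢ D.erase a | z.1 * z.2 ∈ B} + 2 * #{x ∈ D | a * x ∈ B} := by omega
      change ((_ : ℕ) : ℝ) ≤ ((_ : ℕ) : ℝ) + _
      rw [hdg]
      exact_mod_cast h5
    have hdlt : dg < e D / 4 := by
      have h1D : (1 : ℝ) ≤ #D := by exact_mod_cast hDne.card_pos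
      have : dg * 1 ≤ dg * #D := by gcongr
      rw [lt_div_iff₀ (by norm_num)]
      linarith
    have herase : (D.erase a).Nonempty := by
      rw [nonempty_iff_ne_empty]
      intro h0
      rw [h0] at hsplit
      simp only [e, empty_product, filter_empty, card_empty, Nat.cast_zero] at hsplit
      change e D ≤ _ at hsplit
      linarith
    have h6 := hmax (D.erase a) herase.ne_empty ((erase_subset _ _).trans hD.2)
    have hcard : (#(D.erase a) : ℝ) + 1 = #D := by exact_mod_cast card_erase_add_one ha
    have hepos : (0 : ℝ) < #(D.erase a) := by exact_mod_cast herase.card_pos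
    rw [div_le_div_iff₀ hepos hDpos] at h6
    generalize e (D.erase a) = e' at *
    generalize e D = E at *
    generalize (#(D.erase a) : ℝ) = m at *
    generalize (#D : ℝ) = M at *
    subst hcard
    have h7 : (E - 2 * dg) ^ 2 ≤ e' ^ 2 := by
      have : 0 ≤ E - 2 * dg := by linarith
      gcongr
      linarith
    have h8 : (E - 2 * dg) ^ 2 * (m + 1) ≤ E ^ 2 * m :=
      le_trans (mul_le_mul_of_nonneg_right h7 hDpos.le) h6
    nlinarith [mul_pos heD (show 0 < E - dg * (4 * (m + 1)) by linarith),
      mul_nonneg (sq_nonneg dg) hDpos.le]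
  · rw [div_le_div_iff₀ hApos hDpos] at h1
    have h2 : e A ^ 2 * #D ≤ (16 * (e D / (4 * #D)) ^ 2 * #D * #A) * #D := by
      refine h1.trans (le_of_eq ?_)
      field_simp
      ring
    exact le_of_mul_le_mul_right h2 hDpos

/-- The factor g + 2M² is governed by g when M² is at most a multiple of g, and by M² otherwise. The
second regime arises only for the whole field, and it alone produces the alternative containing q.
-/
theorem sum_product_arith {n k U v q N M C g : ℝ} (hn : 1 ≤ n) (hk : 1 ≤ k) (hU : 1 ≤ U)
    (hv : 0 < v) (hN : 0 < N) (hM : 0 < M) (hMn : M ≤ n) (hg : 0 < g)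
    (hNM : n ^ 3 ≤ 16 * v ^ 2 * (N ^ 2 * M))
    (h : M ^ 2 * g ≤ 2 ^ 12 * (U / (N / k) ^ 4) * (g + 2 * M ^ 2))
    (hsub : M ^ 2 ≤ C * g ∨ g = q) (hC : 0 ≤ C) :
    n ^ 6 ≤ 2 ^ 20 * (3 + 2 * C) * (k ^ 4 * v ^ 4 * U) ∨
      q * n ^ 4 ≤ 3 * 2 ^ 20 * (k ^ 4 * v ^ 4 * U) := by
  have hsq : n ^ 6 ≤ 256 * v ^ 4 * (N ^ 4 * M ^ 2) := by
    calc n ^ 6 = (n ^ 3) ^ 2 := by ring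
      _ ≤ (16 * v ^ 2 * (N ^ 2 * M)) ^ 2 := by gcongr
      _ = _ := by ring
  have hn4 : n ^ 4 ≤ 256 * v ^ 4 * N ^ 4 := by
    have : n ^ 4 * n ^ 2 ≤ 256 * v ^ 4 * N ^ 4 * n ^ 2 := by
      calc n ^ 4 * n ^ 2 = n ^ 6 := by ring
        _ ≤ 256 * v ^ 4 * (N ^ 4 * M ^ 2) := hsq
        _ ≤ 256 * v ^ 4 * (N ^ 4 * n ^ 2) := by gcongr
        _ = _ := by ring
    exact le_of_mul_le_mul_right this (by positivity)
  have h' : M ^ 2 * g * N ^ 4 ≤ 2 ^ 12 * (U * k ^ 4) * (g + 2 * M ^ 2) := by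
    have e : 2 ^ 12 * (U / (N / k) ^ 4) * (g + 2 * M ^ 2) * N ^ 4 =
        2 ^ 12 * (U * k ^ 4) * (g + 2 * M ^ 2) := by field_simp
    rw [← e]
    gcongr
  have hUk : 0 ≤ U * k ^ 4 := by positivity
  have case1 : ∀ c : ℝ, 0 ≤ c → M ^ 2 ≤ c * g →
      n ^ 6 ≤ 2 ^ 20 * (1 + 2 * c) * (k ^ 4 * v ^ 4 * U) := by
    intro c hc hMg
    have h2 : (M ^ 2 * N ^ 4) * g ≤ (2 ^ 12 * (U * k ^ 4) * (1 + 2 * c)) * g := by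
      calc (M ^ 2 * N ^ 4) * g = M ^ 2 * g * N ^ 4 := by ring
        _ ≤ 2 ^ 12 * (U * k ^ 4) * (g + 2 * M ^ 2) := h'
        _ ≤ 2 ^ 12 * (U * k ^ 4) * (g + 2 * (c * g)) := by gcongr
        _ = _ := by ring
    have h3 := le_of_mul_le_mul_right h2 hg
    calc n ^ 6 ≤ 256 * v ^ 4 * (N ^ 4 * M ^ 2) := hsq
      _ = 256 * v ^ 4 * (M ^ 2 * N ^ 4) := by ring
      _ ≤ 256 * v ^ 4 * (2 ^ 12 * (U * k ^ 4) * (1 + 2 * c)) := by gcongr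
      _ = _ := by ring
  have hX : 0 ≤ k ^ 4 * v ^ 4 * U := by positivity
  rcases hsub with hs | rfl
  · left
    refine (case1 C hC hs).trans ?_
    gcongr
    norm_num
  · rcases le_or_gt (M ^ 2) g with hMg | hMg
    · left
      have := case1 1 zero_le_one (by linarith)
      have := mul_nonneg hC hX
      linarith
    · right
      have h2 : (g * N ^ 4) * M ^ 2 ≤ (3 * 2 ^ 12 * (U * k ^ 4)) * M ^ 2 := by
        calc (g * N ^ 4) * M ^ 2 = M ^ 2 * g * N ^ 4 := by ring
          _ ≤ 2 ^ 12 * (U * k ^ 4) * (g + 2 * M ^ 2) := h'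
          _ ≤ 2 ^ 12 * (U * k ^ 4) * (M ^ 2 + 2 * M ^ 2) := by gcongr
          _ = _ := by ring
      have h3 := le_of_mul_le_mul_right h2 (by positivity)
      calc g * n ^ 4 ≤ g * (256 * v ^ 4 * N ^ 4) := by gcongr
        _ = 256 * v ^ 4 * (g * N ^ 4) := by ring
        _ ≤ 256 * v ^ 4 * (3 * 2 ^ 12 * (U * k ^ 4)) := by gcongr
        _ = _ := by ring

theorem pivot_arith {n k U v N : ℝ} (hn : 1 ≤ n) (hv : 0 < v) (hNn : n ≤ 4 * v * N) (h : N ^ 5 ≤ 32 * (k ^ 3 * U)) :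
    n ^ 5 ≤ 2 ^ 15 * (k ^ 3 * v ^ 5 * U) := by
  calc n ^ 5 ≤ (4 * v * N) ^ 5 := by gcongr
    _ = 2 ^ 10 * v ^ 5 * N ^ 5 := by ring
    _ ≤ 2 ^ 10 * v ^ 5 * (32 * (k ^ 3 * U)) := by gcongr
    _ = _ := by ring

/-- An energy quadruple x/y = w/u satisfies xu = yw ∈ yA and is recovered from (y, x, u). Averaging
over y selects x₀. -/
theorem exists_popular_dilate {F : Type*} [Field F] [Fintype F] [DecidableEq F] (A : Finset F)
    (hA : A.Nonempty) (h0 : (0 : F) ∉ A) :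
    ∃ x₀ ∈ A, ∑ ξ : F, (quotRep A ξ : ℝ) ^ 2 ≤
      #A * #{z ∈ A ×ˢ A | z.1 * z.2 ∈ A.image (x₀ * ·)} := by
  have hApos : (0 : ℝ) < #A := by exact_mod_cast hA.card_pos
  have hle : ∑ ξ : F, quotRep A ξ ^ 2 ≤
      ∑ x₀ ∈ A, #{z ∈ A ×ˢ A | z.1 * z.2 ∈ A.image (x₀ * ·)} := by
    have h1 : ∀ ξ : F, quotRep A ξ ^ 2 =
        #(({p ∈ A ×ˢ A | p.1 = ξ * p.2} : Finset (F × F)) ×ˢ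
          ({p ∈ A ×ˢ A | p.1 = ξ * p.2} : Finset (F × F))) := fun ξ => by
      rw [card_product, sq]; rfl
    simp only [h1]
    rw [← card_sigma, ← card_sigma]
    refine card_le_card_of_injOn (fun i => ⟨i.2.1.2, (i.2.1.1, i.2.2.2)⟩) ?_ ?_
    · rintro ⟨ξ, ⟨x, y⟩, w, u⟩ hi
      simp only [coe_sigma, Set.mem_sigma_iff, mem_coe, mem_univ, mem_product,
        mem_filter, true_and] at hi ⊢
      obtain ⟨⟨⟨hx, hy⟩, h1⟩, ⟨hw, hu⟩, h2⟩ := hi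
      refine ⟨hy, ⟨hx, hu⟩, mem_image.2 ⟨w, hw, ?_⟩⟩
      rw [h1, h2]; ring
    · rintro ⟨ξ, ⟨x, y⟩, w, u⟩ hi ⟨ξ', ⟨x', y'⟩, w', u'⟩ hi' h
      simp only [coe_sigma, Set.mem_sigma_iff, mem_coe, mem_univ, mem_product,
        mem_filter, true_and] at hi hi'
      obtain ⟨⟨⟨hx, hy⟩, h1⟩, ⟨hw, hu⟩, h2⟩ := hi
      obtain ⟨⟨⟨hx', hy'⟩, h1'⟩, ⟨hw', hu'⟩, h2'⟩ := hi'
      simp only [Sigma.mk.injEq, heq_eq_eq, Prod.mk.injEq] at h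
      obtain ⟨rfl, rfl, rfl⟩ := h
      have hy0 : y ≠ 0 := fun h => h0 (h ▸ hy)
      have hξ : ξ = ξ' := mul_right_cancel₀ hy0 (h1.symm.trans h1')
      subst hξ
      rw [h2, h2']
  obtain ⟨x₀, hx₀, h⟩ : ∃ x₀ ∈ A, (∑ ξ : F, (quotRep A ξ : ℝ) ^ 2) / #A ≤
      #{z ∈ A ×ˢ A | z.1 * z.2 ∈ A.image (x₀ * ·)} := by
    apply exists_le_of_sum_le hA
    rw [sum_const, nsmul_eq_mul, mul_div_cancel₀ _ hApos.ne']
    exact_mod_cast hle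
  refine ⟨x₀, hx₀, ?_⟩
  rw [div_le_iff₀ hApos] at h
  linarith

/-- A sum-product theorem over arbitrary finite fields: a set with few elements in dilates of
proper subfields cannot be both additively and multiplicatively structured. -/
theorem sum_product_energy {F : Type*} [Field F] [Fintype F] [DecidableEq F] (A : Finset F)
    (hA : A.Nonempty) (h0 : (0 : F) ∉ A) (v C : ℝ)
    (hv : (#A : ℝ) ^ 3 ≤ v * ∑ ξ : F, (quotRep A ξ : ℝ) ^ 2)
    (hC : ∀ G : Subfield F, G ≠ ⊤ → ∀ c : F, ∀ D ⊆ A, (∀ x ∈ D, ∃ g ∈ G, x = c * g) →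
      (#D : ℝ) ≤ C * Real.sqrt (Nat.card G)) :
    (#A : ℝ) ^ 6 ≤ 2 ^ 20 * (3 + 2 * C ^ 2) *
        ((#(A - A) : ℝ) ^ 4 * v ^ 4 * #(2 • A - 2 • A)) ∨
      (Fintype.card F : ℝ) * (#A : ℝ) ^ 4 ≤ 3 * 2 ^ 20 *
        ((#(A - A) : ℝ) ^ 4 * v ^ 4 * #(2 • A - 2 • A)) ∨
      (#A : ℝ) ^ 5 ≤ 2 ^ 15 * ((#(A - A) : ℝ) ^ 3 * v ^ 5 * #(2 • A - 2 • A)) := by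
  classical
  have hn1 : (1 : ℝ) ≤ #A := by exact_mod_cast hA.card_pos
  have hk1 : (1 : ℝ) ≤ #(A - A) := by exact_mod_cast (hA.sub hA).card_pos
  have hU1 : (1 : ℝ) ≤ #(2 • A - 2 • A) := by
    have h2 : (2 • A).Nonempty := by rw [two_nsmul]; exact hA.add hA
    exact_mod_cast (h2.sub h2).card_pos
  obtain ⟨x₀, hx₀A, hx₀⟩ := exists_popular_dilate A hA h0
  have hx₀0 : x₀ ≠ 0 := fun h => h0 (h ▸ hx₀A)
  set B : Finset F := A.image (x₀ * ·) with hB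
  have hBU : #(2 • B - 2 • B) = #(2 • A - 2 • A) := card_nsmul_sub_image_mul A x₀ hx₀0
  have hBA : ∀ z ∈ B, z / x₀ ∈ A := by
    intro z hz
    obtain ⟨w, hw, rfl⟩ := mem_image.1 hz
    simpa [mul_div_cancel_left₀ _ hx₀0] using hw
  set E : ℝ := ∑ ξ : F, (quotRep A ξ : ℝ) ^ 2 with hE
  have hE0 : 0 ≤ E := sum_nonneg fun _ _ => sq_nonneg _
  have hvE : 0 < v * E := lt_of_lt_of_le (by positivity) hv
  have hEpos : 0 < E := by
    rcases hE0.lt_or_eq with h | h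
    · exact h
    · rw [← h, mul_zero] at hvE; exact absurd hvE (lt_irrefl _)
  have hv0 : 0 < v := pos_of_mul_pos_left hvE hE0
  have heA : 0 < #{z ∈ A ×ˢ A | z.1 * z.2 ∈ B} := by
    rw [Nat.pos_iff_ne_zero]
    intro h
    rw [h] at hx₀
    simp only [Nat.cast_zero, mul_zero] at hx₀
    linarith
  obtain ⟨D, hDA, hDne, N, hNM', hgood, heN, hN⟩ := exists_regular_subset A B heA
  rw [← hBU] at hU1 ⊢
  have hM : (1 : ℝ) ≤ #D := by exact_mod_cast hDne.card_pos
  have hMn : (#D : ℝ) ≤ #A := by exact_mod_cast card_le_card hDA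
  have htrans' : ∀ a ∈ D, ∀ V ⊆ A, ∃ t : F, (N / #(A - A)) * #V ≤ #{w ∈ V | a * w - t ∈ B} := by
    intro a ha V hV
    obtain ⟨t, ht⟩ := exists_dense_translate A B V {x ∈ D | a * x ∈ B} a hV
      ((filter_subset _ _).trans hDA) (fun x hx => (mem_filter.1 hx).2) hA
    refine ⟨t, ?_⟩
    rw [div_mul_eq_mul_div, div_le_iff₀ (by linarith)]
    refine le_trans ?_ ht
    rw [mul_comm]
    exact mul_le_mul_of_nonneg_left (hgood a ha) (Nat.cast_nonneg _)
  have h0D : (0 : F) ∉ D := fun h => h0 (hDA h)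
  have hsize : (#A : ℝ) ^ 3 ≤ 16 * v ^ 2 * (N ^ 2 * #D) := by
    generalize ((#{z ∈ A ×ˢ A | z.1 * z.2 ∈ B} : ℕ) : ℝ) = e at *
    generalize (#A : ℝ) = n at *
    generalize (#D : ℝ) = M at *
    have hn : 0 < n := by linarith
    have h1 : n * n ^ 2 ≤ n * (v * e) := by
      calc n * n ^ 2 = n ^ 3 := by ring
        _ ≤ v * E := hv
        _ ≤ v * (n * e) := by gcongr
        _ = _ := by ring
    have h2 : n ^ 2 ≤ v * e := le_of_mul_le_mul_left h1 hn
    have h3 : n * n ^ 3 ≤ n * (16 * v ^ 2 * (N ^ 2 * M)) := by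
      calc n * n ^ 3 = (n ^ 2) ^ 2 := by ring
        _ ≤ (v * e) ^ 2 := by gcongr
        _ = v ^ 2 * e ^ 2 := by ring
        _ ≤ v ^ 2 * (16 * N ^ 2 * M * n) := by gcongr
        _ = _ := by ring
    exact le_of_mul_le_mul_left h3 hn
  have hNn : (#A : ℝ) ≤ 4 * v * N := by
    generalize (#A : ℝ) = n at *
    generalize (#D : ℝ) = M at *
    have hn : 0 < n := by linarith
    refine le_of_sq_le_sq ?_ (by positivity)
    have h3 : n * n ^ 2 ≤ n * (4 * v * N) ^ 2 := by
      calc n * n ^ 2 = n ^ 3 := by ring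
        _ ≤ 16 * v ^ 2 * (N ^ 2 * M) := hsize
        _ ≤ 16 * v ^ 2 * (N ^ 2 * n) := by gcongr
        _ = _ := by ring
    exact le_of_mul_le_mul_left h3 hn
  have hp : 0 < N / (#(A - A) : ℝ) := div_pos hN (by linarith)
  -- Failure of either closure property gives the fifth-power alternative through a pivot; if both
  -- hold, R is a subfield as soon as D has two elements.
  by_cases hadd : ∀ r ∈ ratioSet D, r + 1 ∈ ratioSet D
  swap
  · push Not at hadd
    obtain ⟨r, hr, hr1⟩ := hadd
    have h := pivot_add_one hA hDA hp hN hgood htrans' r hr hr1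
    right; right
    generalize (#(A - A) : ℝ) = k at *
    generalize (#(2 • B - 2 • B) : ℝ) = U at *
    have hk : 0 < k := by linarith
    refine pivot_arith hn1 hv0 hNn ?_
    have e1 : N / k * N * (N / 2) ^ 2 = N ^ 4 / (4 * k) := by field_simp; norm_num
    have e2 : 4 * (k * (2 / (N / k) * U)) = 8 * k ^ 2 * U / N := by field_simp; norm_num
    rw [e1, e2, div_le_div_iff₀ (by positivity) hN] at h
    calc N ^ 5 = N ^ 4 * N := by ring
      _ ≤ _ := h
      _ = _ := by ring
  by_cases hmul : ∀ e ∈ D, ∀ r ∈ ratioSet D, e / x₀ * r ∈ ratioSet D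
  swap
  · push Not at hmul
    obtain ⟨e, he, r, hr, hr1⟩ := hmul
    have h := pivot_mul x₀ hx₀0 hDA hp hN hBA hgood htrans' r e he hr hr1
      (fun h => h0D (h ▸ he))
    right; right
    generalize (#(A - A) : ℝ) = k at *
    generalize (#(2 • B - 2 • B) : ℝ) = U at *
    have hk : 0 < k := by linarith
    refine pivot_arith hn1 hv0 hNn ?_
    have e1 : N / k * N * (N / k * (N / k * N)) = N ^ 5 / k ^ 3 := by field_simp
    rw [e1, div_le_iff₀ (by positivity)] at h
    have : 0 ≤ k ^ 3 * U := by positivity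
    linarith
  by_cases hDnt : D.Nontrivial
  swap
  · left
    -- For a singleton the ratio set is empty and closure is vacuous. Then N ≤ 1/4, and the size
    -- inequality alone gives n³ ≤ v².
    have hD1 : (#D : ℝ) = 1 := by
      have h1 : #D ≤ 1 := by
        by_contra! h
        exact hDnt (one_lt_card_iff_nontrivial.1 h)
      have h2 := hDne.card_pos
      have : #D = 1 := by omega
      exact_mod_cast this
    rw [hD1] at hsize hNM'
    generalize (#(A - A) : ℝ) = k at *
    generalize (#(2 • B - 2 • B) : ℝ) = U at *
    generalize (#A : ℝ) = n at *
    have hN4 : N ≤ 1 / 4 := by linarith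
    have hN2 : N ^ 2 ≤ (1 / 4) ^ 2 := by gcongr
    have h3 : n ^ 3 ≤ v ^ 2 := by
      calc n ^ 3 ≤ 16 * v ^ 2 * (N ^ 2 * 1) := hsize
        _ ≤ 16 * v ^ 2 * ((1 / 4) ^ 2 * 1) := by gcongr
        _ = _ := by ring
    have hk4 : 1 ≤ k ^ 4 := one_le_pow₀ hk1
    calc n ^ 6 = (n ^ 3) ^ 2 := by ring
      _ ≤ (v ^ 2) ^ 2 := by gcongr
      _ = 1 * (1 * v ^ 4 * 1) := by ring
      _ ≤ 2 ^ 20 * (3 + 2 * C ^ 2) * (k ^ 4 * v ^ 4 * U) := by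
        gcongr
        have := sq_nonneg C
        linarith
  · obtain ⟨G, hG, hDG⟩ := exists_subfield_eq_ratioSet D x₀ hx₀0 h0D hDnt hadd hmul
    have hfc := field_case hDA hp hDne htrans' G hG
    have hgpos : (0 : ℝ) < Nat.card G := by exact_mod_cast Nat.card_pos
    have hsub : (#D : ℝ) ^ 2 ≤ C ^ 2 * Nat.card G ∨ (Nat.card G : ℝ) = Fintype.card F := by
      by_cases hGt : G = ⊤
      · right
        subst hGt
        rw [← Nat.card_eq_fintype_card]
        congr 1
        exact Nat.card_congr Subfield.topEquiv.toEquiv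
      · left
        -- D lies in the single dilate x₀G, so the hypothesis on proper subfields bounds all of D.
        have h1 := hC G hGt x₀ D hDA (fun x hx => ⟨x / x₀, hDG x hx, by field_simp⟩)
        calc (#D : ℝ) ^ 2 ≤ (C * Real.sqrt (Nat.card G)) ^ 2 := by gcongr
          _ = _ := by rw [mul_pow, Real.sq_sqrt hgpos.le]
    rcases sum_product_arith hn1 hk1 hU1 hv0 hN (by linarith) hMn hgpos hsize hfc hsub
      (sq_nonneg C) with h | h
    · exact Or.inl h
    · exact Or.inr (Or.inl h)

end SumProduct

/-! ### Exponential sums and energies -/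

section ExponentialSums

variable {F : Type*} [Field F] [Fintype F] [DecidableEq F]

/-- The number of representations of `u` as a product of an element of `A` and one of `B`. -/
def prodRep {R : Type*} [Mul R] [DecidableEq R] (A B : Finset R) (u : R) : ℕ := #{p ∈ A ×ˢ B | p.1 * p.2 = u}

theorem parseval (ψ : AddChar F ℂ) (hψ : ψ.IsPrimitive) (ρ : F → ℂ) :
    ∑ y, ‖∑ u, ρ u * ψ (y * u)‖ ^ 2 = Fintype.card F * ∑ u, ‖ρ u‖ ^ 2 := by
  have key : ∀ y, ((‖∑ u, ρ u * ψ (y * u)‖ ^ 2 : ℝ) : ℂ) =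
      ∑ u, ∑ v, ρ u * conj (ρ v) * ψ (y * (u - v)) := by
    intro y
    rw [← Complex.normSq_eq_norm_sq, Complex.normSq_eq_conj_mul_self, mul_comm, map_sum, sum_mul_sum]
    refine sum_congr rfl fun u _ => sum_congr rfl fun v _ => ?_
    rw [map_mul (starRingEnd ℂ), ← AddChar.map_neg_eq_conj, mul_sub, sub_eq_add_neg,
      AddChar.map_add_eq_mul]
    ring
  have h : ((∑ y, ‖∑ u, ρ u * ψ (y * u)‖ ^ 2 : ℝ) : ℂ) =
      ((Fintype.card F * ∑ u, ‖ρ u‖ ^ 2 : ℝ) : ℂ) := by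
    rw [Complex.ofReal_sum]
    simp only [key]
    rw [sum_comm]
    rw [Complex.ofReal_mul, Complex.ofReal_sum, mul_sum]
    refine sum_congr rfl fun u _ => ?_
    rw [sum_comm]
    simp only [← mul_sum, AddChar.sum_mulShift _ hψ, sub_eq_zero]
    rw [sum_eq_single u]
    · rw [if_pos rfl, ← Complex.normSq_eq_norm_sq, Complex.normSq_eq_conj_mul_self]
      push_cast
      ring
    · intro v _ hv
      rw [if_neg (Ne.symm hv)]; simp
    · simp
  exact_mod_cast h

theorem sum_fibre_mul {ι R : Type*} [Fintype R] [DecidableEq R] (s : Finset ι) (π : ι → R)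
    (g : ι → ℂ) (h : R → ℂ) :
    ∑ i ∈ s, g i * h (π i) = ∑ u, (∑ i ∈ s with π i = u, g i) * h u := by
  rw [← sum_fiberwise s π]
  refine sum_congr rfl fun u _ => ?_
  rw [sum_mul]
  refine sum_congr rfl fun i hi => ?_
  rw [(mem_filter.1 hi).2]

theorem norm_sum_le_card {ι : Type*} (s : Finset ι) (g : ι → ℂ) (hg : ∀ i ∈ s, ‖g i‖ ≤ 1) :
    ‖∑ i ∈ s, g i‖ ≤ #s := by
  refine (norm_sum_le_of_le s hg).trans ?_
  simp

/-- The bilinear bound for one variable `y` against a weighted variable `u`. -/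
theorem bilinear_bound (ψ : AddChar F ℂ) (hψ : ψ.IsPrimitive) (Y : Finset F) (β ρ : F → ℂ)
    (hβ : ∀ y ∈ Y, ‖β y‖ ≤ 1) :
    ‖∑ y ∈ Y, β y * ∑ u, ρ u * ψ (y * u)‖ ^ 2 ≤
      #Y * (Fintype.card F * ∑ u, ‖ρ u‖ ^ 2) := by
  have h1 : ‖∑ y ∈ Y, β y * ∑ u, ρ u * ψ (y * u)‖ ≤ ∑ y ∈ Y, ‖∑ u, ρ u * ψ (y * u)‖ := by
    refine norm_sum_le_of_le _ fun y hy => ?_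
    rw [norm_mul]
    exact mul_le_of_le_one_left (norm_nonneg _) (hβ y hy)
  calc _ ≤ (∑ y ∈ Y, ‖∑ u, ρ u * ψ (y * u)‖) ^ 2 := by gcongr
    _ ≤ #Y * ∑ y ∈ Y, ‖∑ u, ρ u * ψ (y * u)‖ ^ 2 := sq_sum_le_card_mul_sum_sq
    _ ≤ #Y * ∑ y, ‖∑ u, ρ u * ψ (y * u)‖ ^ 2 := by
        gcongr
        exact subset_univ _
    _ = _ := by rw [parseval ψ hψ]

/-- A trilinear sum is controlled by the multiplicative energy of two of its variables. -/
theorem norm_sq_le_prodRep (ψ : AddChar F ℂ) (hψ : ψ.IsPrimitive) (A Y Z : Finset F)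
    (c β γ : F → ℂ) (hc : ∀ x ∈ A, ‖c x‖ ≤ 1) (hβ : ∀ y ∈ Y, ‖β y‖ ≤ 1)
    (hγ : ∀ z ∈ Z, ‖γ z‖ ≤ 1) :
    ‖∑ x ∈ A, c x * ∑ y ∈ Y, ∑ z ∈ Z, β y * γ z * ψ (x * y * z)‖ ^ 2 ≤
      #Y * (Fintype.card F * ∑ u, (prodRep A Z u : ℝ) ^ 2) := by
  let ρ : F → ℂ := fun u => ∑ p ∈ A ×ˢ Z with p.1 * p.2 = u, c p.1 * γ p.2
  have h : ∑ x ∈ A, c x * ∑ y ∈ Y, ∑ z ∈ Z, β y * γ z * ψ (x * y * z) =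
      ∑ y ∈ Y, β y * ∑ u, ρ u * ψ (y * u) := by
    have h1 : ∀ y, ∑ u, ρ u * ψ (y * u) =
        ∑ x ∈ A, ∑ z ∈ Z, c x * γ z * ψ (y * (x * z)) := by
      intro y
      rw [← sum_product', ← sum_fibre_mul (A ×ˢ Z) (fun p => p.1 * p.2)
        (fun p => c p.1 * γ p.2) (fun u => ψ (y * u))]
    simp only [h1, mul_sum]
    rw [sum_comm]
    refine sum_congr rfl fun y _ => sum_congr rfl fun x _ => sum_congr rfl fun z _ => ?_
    rw [show x * y * z = y * (x * z) by ring]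
    ring
  rw [h]
  refine (bilinear_bound ψ hψ Y β ρ hβ).trans ?_
  gcongr with u
  refine norm_sum_le_card _ _ fun p hp => ?_
  have hp' := mem_product.1 (mem_filter.1 hp).1
  rw [norm_mul]
  exact mul_le_one₀ (hc _ hp'.1) (norm_nonneg _) (hγ _ hp'.2)

theorem sum_diffRep (A : Finset F) :
    ∑ p ∈ A ×ˢ A, (diffRep A (p.1 - p.2) : ℝ) = ∑ d, (diffRep A d : ℝ) ^ 2 := by
  rw [← sum_fiberwise (A ×ˢ A) (fun p => p.1 - p.2)]
  refine sum_congr rfl fun d _ => ?_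
  rw [sum_congr rfl (g := fun _ => (diffRep A d : ℝ))
    (fun p hp => by rw [(mem_filter.1 hp).2]), sum_const, nsmul_eq_mul, sq]
  rfl

/-- The squared modulus of the sum is the transform of the weighted count σ of differences, so
Parseval for σ gives the fourth moment. -/
theorem sum_norm_pow_four_le (ψ : AddChar F ℂ) (hψ : ψ.IsPrimitive) (A : Finset F) (c : F → ℂ)
    (hc : ∀ x ∈ A, ‖c x‖ ≤ 1) :
    ∑ u, ‖∑ x ∈ A, c x * ψ (x * u)‖ ^ 4 ≤
      Fintype.card F * ∑ p ∈ A ×ˢ A, (diffRep A (p.1 - p.2) : ℝ) := by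
  let σ : F → ℂ := fun d => ∑ p ∈ A ×ˢ A with p.1 - p.2 = d, c p.1 * conj (c p.2)
  have h : ∀ u, ‖∑ x ∈ A, c x * ψ (x * u)‖ ^ 4 = ‖∑ d, σ d * ψ (u * d)‖ ^ 2 := by
    intro u
    have h1 : ∑ d, σ d * ψ (u * d) =
        (∑ x ∈ A, c x * ψ (x * u)) * conj (∑ x ∈ A, c x * ψ (x * u)) := by
      rw [← sum_fibre_mul (A ×ˢ A) (fun p => p.1 - p.2)
        (fun p => c p.1 * conj (c p.2)) (fun d => ψ (u * d)), map_sum, sum_mul_sum, sum_product]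
      refine sum_congr rfl fun x _ => sum_congr rfl fun y _ => ?_
      rw [map_mul (starRingEnd ℂ), ← AddChar.map_neg_eq_conj, mul_sub, sub_eq_add_neg, AddChar.map_add_eq_mul,
        mul_comm u x, mul_comm u y]
      ring
    rw [h1, norm_mul, RCLike.norm_conj]
    ring
  simp only [h]
  rw [parseval ψ hψ, sum_diffRep]
  gcongr with d
  refine norm_sum_le_card _ _ fun p hp => ?_
  have hp' := mem_product.1 (mem_filter.1 hp).1
  rw [norm_mul, RCLike.norm_conj]
  exact mul_le_one₀ (hc _ hp'.1) (norm_nonneg _) (hc _ hp'.2)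

/-- Cauchy–Schwarz twice: first split rf as √r · √r f, then rf² as r · f². -/
theorem sum_mul_pow_four_le {ι : Type*} (s : Finset ι) (r f : ι → ℝ) (hr : ∀ i, 0 ≤ r i) :
    (∑ i ∈ s, r i * f i) ^ 4 ≤
      (∑ i ∈ s, r i) ^ 2 * ((∑ i ∈ s, r i ^ 2) * ∑ i ∈ s, f i ^ 4) := by
  have h1 : (∑ i ∈ s, r i * f i) ^ 2 ≤ (∑ i ∈ s, r i) * ∑ i ∈ s, r i * f i ^ 2 := by
    have := sum_mul_sq_le_sq_mul_sq s (fun i => Real.sqrt (r i)) (fun i => Real.sqrt (r i) * f i)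
    simpa only [← mul_assoc, Real.mul_self_sqrt (hr _), mul_pow, Real.sq_sqrt (hr _)] using this
  have h2 : (∑ i ∈ s, r i * f i ^ 2) ^ 2 ≤ (∑ i ∈ s, r i ^ 2) * ∑ i ∈ s, f i ^ 4 := by
    have := sum_mul_sq_le_sq_mul_sq s r (fun i => f i ^ 2)
    simpa only [← pow_mul] using this
  have h0 : 0 ≤ ∑ i ∈ s, r i * f i ^ 2 := sum_nonneg fun i _ => mul_nonneg (hr i) (sq_nonneg _)
  calc (∑ i ∈ s, r i * f i) ^ 4 = ((∑ i ∈ s, r i * f i) ^ 2) ^ 2 := by ring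
    _ ≤ ((∑ i ∈ s, r i) * ∑ i ∈ s, r i * f i ^ 2) ^ 2 := by gcongr
    _ = (∑ i ∈ s, r i) ^ 2 * (∑ i ∈ s, r i * f i ^ 2) ^ 2 := by ring
    _ ≤ _ := by gcongr

theorem sum_prodRep (Y Z : Finset F) : ∑ u, (prodRep Y Z u : ℝ) = #Y * #Z := by
  have h := card_eq_sum_card_fiberwise (f := fun p : F × F => p.1 * p.2) (s := Y ×ˢ Z)
    (t := univ) (fun _ _ => mem_univ _)
  rw [card_product] at h
  exact_mod_cast h.symm

theorem prodRep_le {R : Type*} [Field R] [DecidableEq R] (Y Z : Finset R)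
    (hZ : (0 : R) ∉ Z) (u : R) : prodRep Y Z u ≤ #Z := by
  refine card_le_card_of_injOn Prod.snd ?_ ?_
  · intro p hp
    exact (mem_product.1 (mem_filter.1 (mem_coe.1 hp)).1).2
  · rintro ⟨y, z⟩ hp ⟨y', z'⟩ hp' h
    simp only [mem_coe, mem_filter, mem_product] at hp hp' h
    subst h
    have hz : z ≠ 0 := fun h => hZ (h ▸ hp.1.2)
    rw [mul_right_cancel₀ hz (hp.2.trans hp'.2.symm)]

theorem sum_prodRep_sq_le (Y Z : Finset F) (hZ : (0 : F) ∉ Z) :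
    ∑ u, (prodRep Y Z u : ℝ) ^ 2 ≤ #Y * (#Z : ℝ) ^ 2 := by
  calc ∑ u, (prodRep Y Z u : ℝ) ^ 2 ≤ ∑ u, #Z * (prodRep Y Z u : ℝ) := by
        refine sum_le_sum fun u _ => ?_
        rw [sq]
        gcongr
        exact prodRep_le Y Z hZ u
    _ = _ := by rw [← mul_sum, sum_prodRep]; ring

/-- A trilinear sum is controlled by the additive energy of one variable. -/
theorem norm_pow_four_le_diffRep (ψ : AddChar F ℂ) (hψ : ψ.IsPrimitive) (A Y Z : Finset F)
    (hZ : (0 : F) ∉ Z) (c β γ : F → ℂ) (hc : ∀ x ∈ A, ‖c x‖ ≤ 1) (hβ : ∀ y ∈ Y, ‖β y‖ ≤ 1)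
    (hγ : ∀ z ∈ Z, ‖γ z‖ ≤ 1) :
    ‖∑ x ∈ A, c x * ∑ y ∈ Y, ∑ z ∈ Z, β y * γ z * ψ (x * y * z)‖ ^ 4 ≤
      ((#Y : ℝ) * #Z) ^ 2 * ((#Y * (#Z : ℝ) ^ 2) *
        (Fintype.card F * ∑ p ∈ A ×ˢ A, (diffRep A (p.1 - p.2) : ℝ))) := by
  let w : F → ℂ := fun u => ∑ p ∈ Y ×ˢ Z with p.1 * p.2 = u, β p.1 * γ p.2
  have hw : ∀ u, ‖w u‖ ≤ prodRep Y Z u := fun u => by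
    refine norm_sum_le_card _ _ fun p hp => ?_
    have hp' := mem_product.1 (mem_filter.1 hp).1
    rw [norm_mul]
    exact mul_le_one₀ (hβ _ hp'.1) (norm_nonneg _) (hγ _ hp'.2)
  have h : ∑ x ∈ A, c x * ∑ y ∈ Y, ∑ z ∈ Z, β y * γ z * ψ (x * y * z) =
      ∑ u, w u * ∑ x ∈ A, c x * ψ (x * u) := by
    have h1 : ∀ x, ∑ y ∈ Y, ∑ z ∈ Z, β y * γ z * ψ (x * y * z) = ∑ u, w u * ψ (x * u) := by
      intro x
      rw [← sum_product', ← sum_fibre_mul (Y ×ˢ Z) (fun p => p.1 * p.2)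
        (fun p => β p.1 * γ p.2) (fun u => ψ (x * u))]
      refine sum_congr rfl fun p _ => ?_
      rw [mul_assoc x]
    simp only [h1, mul_sum]
    rw [sum_comm]
    refine sum_congr rfl fun y _ => sum_congr rfl fun x _ => ?_
    ring
  rw [h]
  have h2 : ‖∑ u, w u * ∑ x ∈ A, c x * ψ (x * u)‖ ≤
      ∑ u, (prodRep Y Z u : ℝ) * ‖∑ x ∈ A, c x * ψ (x * u)‖ := by
    refine norm_sum_le_of_le _ fun u _ => ?_
    rw [norm_mul]
    gcongr
    exact hw u
  calc _ ≤ (∑ u, (prodRep Y Z u : ℝ) * ‖∑ x ∈ A, c x * ψ (x * u)‖) ^ 4 := by gcongr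
    _ ≤ _ := sum_mul_pow_four_le univ _ _ (fun _ => Nat.cast_nonneg _)
    _ ≤ _ := by
      rw [sum_prodRep]
      gcongr
      · exact sum_prodRep_sq_le Y Z hZ
      · exact sum_norm_pow_four_le ψ hψ A c hc

theorem quotRep_le {R : Type*} [Field R] [DecidableEq R] (A : Finset R) (ξ : R) : quotRep A ξ ≤ #A := by
  refine card_le_card_of_injOn Prod.snd ?_ ?_
  · intro p hp
    exact (mem_product.1 (mem_filter.1 (mem_coe.1 hp)).1).2
  · rintro ⟨y, z⟩ hp ⟨y', z'⟩ hp' h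
    simp only [mem_coe, mem_filter, mem_product] at hp hp' h
    subst h
    rw [hp.2, hp'.2]

theorem sum_quotRep (A : Finset F) (hA : (0 : F) ∉ A) : ∑ ξ, (quotRep A ξ : ℝ) = (#A : ℝ) ^ 2 := by
  have h := card_eq_sum_card_fiberwise (f := fun p : F × F => p.1 / p.2) (s := A ×ˢ A)
    (t := univ) (fun _ _ => mem_univ _)
  rw [card_product, ← sq] at h
  rw [← Nat.cast_pow, h]
  push_cast
  refine sum_congr rfl fun ξ _ => ?_
  rw [quotRep]
  congr 2
  ext ⟨x, y⟩
  simp only [mem_filter, mem_product, and_congr_right_iff]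
  rintro ⟨-, hy⟩
  have hy0 : y ≠ 0 := fun h => hA (h ▸ hy)
  rw [div_eq_iff hy0]

theorem sum_quotRep_sq_le (A : Finset F) (hA : (0 : F) ∉ A) :
    ∑ ξ, (quotRep A ξ : ℝ) ^ 2 ≤ (#A : ℝ) ^ 3 := by
  calc ∑ ξ, (quotRep A ξ : ℝ) ^ 2 ≤ ∑ ξ, #A * (quotRep A ξ : ℝ) := by
        refine sum_le_sum fun ξ _ => ?_
        rw [sq]
        gcongr
        exact quotRep_le A ξ
    _ = _ := by rw [← mul_sum, sum_quotRep A hA]; ring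

/-- An equality xz = x'z' is a common quotient x/x' = z'/z, so the mixed energy is at most a
correlation of the two quotient counts, to which Cauchy–Schwarz applies. -/
theorem sum_prodRep_sq_sq_le (A Z : Finset F) (hA : (0 : F) ∉ A) :
    (∑ u, (prodRep A Z u : ℝ) ^ 2) ^ 2 ≤
      (∑ ξ, (quotRep A ξ : ℝ) ^ 2) * ∑ ξ, (quotRep Z ξ : ℝ) ^ 2 := by
  have hle : ∑ u, prodRep A Z u ^ 2 ≤ ∑ ξ, quotRep A ξ * quotRep Z ξ := by
    have h1 : ∀ u : F, prodRep A Z u ^ 2 =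
        #(({p ∈ A ×ˢ Z | p.1 * p.2 = u} : Finset (F × F)) ×ˢ
          ({p ∈ A ×ˢ Z | p.1 * p.2 = u} : Finset (F × F))) := fun u => by
      rw [card_product, sq]; rfl
    have h2 : ∀ ξ : F, quotRep A ξ * quotRep Z ξ =
        #(({p ∈ A ×ˢ A | p.1 = ξ * p.2} : Finset (F × F)) ×ˢ
          ({p ∈ Z ×ˢ Z | p.1 = ξ * p.2} : Finset (F × F))) := fun ξ => by
      rw [card_product]; rfl
    simp only [h1, h2]
    rw [← card_sigma, ← card_sigma]
    refine card_le_card_of_injOn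
      (fun i => ⟨i.2.1.1 / i.2.2.1, ((i.2.1.1, i.2.2.1), (i.2.2.2, i.2.1.2))⟩) ?_ ?_
    · rintro ⟨u, ⟨x, z⟩, x', z'⟩ hi
      simp only [coe_sigma, Set.mem_sigma_iff, mem_coe, mem_univ, mem_product,
        mem_filter, true_and] at hi ⊢
      obtain ⟨⟨⟨hx, hz⟩, h3⟩, ⟨hx', hz'⟩, h4⟩ := hi
      have hx0 : x' ≠ 0 := fun h => hA (h ▸ hx')
      refine ⟨⟨⟨hx, hx'⟩, (div_mul_cancel₀ _ hx0).symm⟩, ⟨hz', hz⟩, ?_⟩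
      rw [div_mul_eq_mul_div, eq_div_iff hx0, h3, ← h4, mul_comm]
    · rintro ⟨u, ⟨x, z⟩, x', z'⟩ hi ⟨v, ⟨y, w⟩, y', w'⟩ hi' h
      simp only [coe_sigma, Set.mem_sigma_iff, mem_coe, mem_univ, mem_product,
        mem_filter, true_and] at hi hi'
      simp only [Sigma.mk.injEq, heq_eq_eq, Prod.mk.injEq] at h
      obtain ⟨-, ⟨rfl, rfl⟩, rfl, rfl⟩ := h
      have : u = v := hi.1.2.symm.trans hi'.1.2
      subst this
      rfl
  have hle' : ∑ u, (prodRep A Z u : ℝ) ^ 2 ≤ ∑ ξ, (quotRep A ξ : ℝ) * quotRep Z ξ := by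
    exact_mod_cast hle
  calc _ ≤ (∑ ξ, (quotRep A ξ : ℝ) * quotRep Z ξ) ^ 2 := by
        have : 0 ≤ ∑ u, (prodRep A Z u : ℝ) ^ 2 := sum_nonneg fun _ _ => sq_nonneg _
        gcongr
    _ ≤ _ := sum_mul_sq_le_sq_mul_sq _ _ _

/-- Unimodular c x aligning the inner sums make the sum over A at least t|A|. Only the lower bound
on A is used, so the estimates are inherited by subsets. -/
theorem energies_of_large_sum (ψ : AddChar F ℂ) (hψ : ψ.IsPrimitive) (A Y Z : Finset F)
    (hA : (0 : F) ∉ A) (hZ : (0 : F) ∉ Z) (β γ : F → ℂ) (hβ : ∀ y ∈ Y, ‖β y‖ ≤ 1)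
    (hγ : ∀ z ∈ Z, ‖γ z‖ ≤ 1) (t : ℝ) (ht : 0 ≤ t)
    (hAt : ∀ x ∈ A, t ≤ ‖∑ y ∈ Y, ∑ z ∈ Z, β y * γ z * ψ (x * y * z)‖) :
    (t * #A) ^ 4 ≤ (Fintype.card F : ℝ) ^ 2 * (#Y : ℝ) ^ 2 * (#Z : ℝ) ^ 3 *
        ∑ ξ, (quotRep A ξ : ℝ) ^ 2 ∧
      (t * #A) ^ 4 ≤ Fintype.card F * (#Y : ℝ) ^ 3 * (#Z : ℝ) ^ 4 *
        ∑ p ∈ A ×ˢ A, (diffRep A (p.1 - p.2) : ℝ) := by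
  let g : F → ℂ := fun x => ∑ y ∈ Y, ∑ z ∈ Z, β y * γ z * ψ (x * y * z)
  have hphase : ∀ x, ∃ c : ℂ, ‖c‖ = 1 ∧ ((‖g x‖ : ℝ) : ℂ) = c * g x := fun x =>
    RCLike.exists_norm_eq_mul_self (g x)
  choose c hc hcg using hphase
  have hsum : t * #A ≤ ‖∑ x ∈ A, c x * g x‖ := by
    simp only [← hcg]
    rw [← Complex.ofReal_sum, Complex.norm_real, Real.norm_of_nonneg
      (sum_nonneg fun _ _ => norm_nonneg _)]
    calc t * #A = ∑ x ∈ A, t := by rw [sum_const, nsmul_eq_mul, mul_comm]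
      _ ≤ _ := sum_le_sum hAt
  have htA : 0 ≤ t * #A := mul_nonneg ht (Nat.cast_nonneg _)
  constructor
  · have h1 := norm_sq_le_prodRep ψ hψ A Y Z c β γ (fun x _ => (hc x).le) hβ hγ
    have h2 := sum_prodRep_sq_sq_le A Z hA
    have h3 := sum_quotRep_sq_le Z hZ
    have hE : 0 ≤ ∑ ξ, (quotRep A ξ : ℝ) ^ 2 := sum_nonneg fun _ _ => sq_nonneg _
    calc (t * #A) ^ 4 = ((t * #A) ^ 2) ^ 2 := by ring
      _ ≤ (‖∑ x ∈ A, c x * g x‖ ^ 2) ^ 2 := by gcongr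
      _ ≤ (#Y * (Fintype.card F * ∑ u, (prodRep A Z u : ℝ) ^ 2)) ^ 2 := by gcongr
      _ = (#Y : ℝ) ^ 2 * (Fintype.card F : ℝ) ^ 2 * (∑ u, (prodRep A Z u : ℝ) ^ 2) ^ 2 := by ring
      _ ≤ (#Y : ℝ) ^ 2 * (Fintype.card F : ℝ) ^ 2 *
          ((∑ ξ, (quotRep A ξ : ℝ) ^ 2) * (#Z : ℝ) ^ 3) := by
        gcongr
        exact h2.trans (by gcongr)
      _ = _ := by ring
  · have h1 := norm_pow_four_le_diffRep ψ hψ A Y Z hZ c β γ (fun x _ => (hc x).le) hβ hγ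
    calc (t * #A) ^ 4 ≤ ‖∑ x ∈ A, c x * g x‖ ^ 4 := by gcongr
      _ ≤ _ := h1
      _ = _ := by ring

end ExponentialSums

/-! ### The canonical character -/

/-- The canonical additive character as an `AddChar`. -/
theorem exists_addChar_eq_canonicalChar (p : ℕ) [Fact p.Prime] (F : Type*) [Field F] [Fintype F]
    [Algebra (ZMod p) F] :
    ∃ ψ : AddChar F ℂ, ψ.IsPrimitive ∧ ∀ x, canonicalChar p F x = ψ x := by
  have : NeZero p := ⟨(Fact.out : p.Prime).ne_zero⟩
  let ψ : AddChar F ℂ :=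
    (ZMod.stdAddChar (N := p)).compAddMonoidHom (Algebra.trace (ZMod p) F).toAddMonoidHom
  have happ : ∀ x, ψ x = ZMod.stdAddChar (N := p) (Algebra.trace (ZMod p) F x) := fun _ => rfl
  refine ⟨ψ, AddChar.IsPrimitive.of_ne_one ?_, fun x => ?_⟩
  · intro h
    -- Over a field nontriviality suffices for primitivity, and surjectivity of the trace provides
    -- it.
    have hsurj := Algebra.trace_surjective (ZMod p) F
    obtain ⟨x, hx⟩ := hsurj 1
    have h1 : ψ x = 1 := by rw [h]; rfl
    rw [happ, hx] at h1
    have h2 := ZMod.injective_stdAddChar (N := p)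
    have h3 : (1 : ZMod p) = 0 := h2 (by rw [h1, AddChar.map_zero_eq_one])
    have : Fact (1 < p) := ⟨(Fact.out : p.Prime).one_lt⟩
    exact one_ne_zero h3
  · rw [happ, canonicalChar]
    have h := ZMod.stdAddChar_coe (N := p) ((Algebra.trace (ZMod p) F x).val : ℤ)
    rw [Int.cast_natCast, ZMod.natCast_zmod_val] at h
    rw [h]
    push_cast
    rfl

/-! ### Bounds for level sets -/

theorem le_of_le_mul_div {P N R : ℝ} (hP : 0 < P) (hN : 0 < N) (h : P ≤ P * R / N) : N ≤ R := by
  rw [mul_div_assoc] at h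
  exact (one_le_div hN).1 ((le_mul_iff_one_le_right hP).1 h)

/-- The parameter v on the subset satisfies vn = wN, so a power of n is multiplied in to complete
each power of v. Then n ≥ αN/8 leaves surplus factors α³ and α⁵ in the first two cases, absorbed by
α ≤ 8; in the third the powers of α cancel exactly. -/
theorem card_bounds_of_sum_product {n k U w v N α J c q : ℝ} (hn : 0 < n) (hN : 0 < N) (hα : 0 < α)
    (hnα : α * N / 8 ≤ n) (hnN : n ≤ N) (hw : 0 ≤ w) (hk0 : 0 ≤ k) (hU0 : 0 ≤ U)
    (hc : 0 ≤ c) (hq : 0 ≤ q) (hv : v = w * N / n) (hk : k ≤ 2 ^ 21 * J ^ 4 * α ^ 3 * N)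
    (hU : U ≤ 2 ^ 70 * J ^ 12 * α * N)
    (h : n ^ 6 ≤ c * (k ^ 4 * v ^ 4 * U) ∨ q * n ^ 4 ≤ c * (k ^ 4 * v ^ 4 * U) ∨
      n ^ 5 ≤ c * (k ^ 3 * v ^ 5 * U)) :
    N ≤ 2 ^ 193 * c * (J ^ 28 * w ^ 4) ∨ q ≤ 2 ^ 193 * c * (J ^ 28 * w ^ 4 * N) ∨
      N ≤ 2 ^ 193 * c * (J ^ 24 * w ^ 5) := by
  have hα8 : α ≤ 8 := by
    by_contra hcon
    nlinarith
  have hvn : v * n = w * N := by rw [hv]; field_simp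
  have hαn : α * N ≤ 8 * n := by linarith
  have hmain : k ^ 4 * (w * N) ^ 4 * U ≤
      2 ^ 154 * (J ^ 28 * w ^ 4) * α ^ 13 * N ^ 9 := by
    calc k ^ 4 * (w * N) ^ 4 * U ≤ (2 ^ 21 * J ^ 4 * α ^ 3 * N) ^ 4 * (w * N) ^ 4 *
          (2 ^ 70 * J ^ 12 * α * N) := by gcongr
      _ = _ := by ring
  have hR : ∀ i : ℕ, 0 ≤ 2 ^ i * c * (J ^ 28 * w ^ 4) := fun i => by positivity
  rcases h with h | h | h
  · left
    have h1 : (α * N) ^ 10 ≤ (α * N) ^ 10 * (2 ^ 184 * c * (J ^ 28 * w ^ 4) * α ^ 3) / N := by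
      calc (α * N) ^ 10 ≤ (8 * n) ^ 10 := by gcongr
        _ = 8 ^ 10 * n ^ 4 * n ^ 6 := by ring
        _ ≤ 8 ^ 10 * n ^ 4 * (c * (k ^ 4 * v ^ 4 * U)) := by gcongr
        _ = 8 ^ 10 * c * (k ^ 4 * (v * n) ^ 4 * U) := by ring
        _ ≤ 8 ^ 10 * c * (2 ^ 154 * (J ^ 28 * w ^ 4) * α ^ 13 * N ^ 9) := by
          rw [hvn]; gcongr
        _ = _ := by field_simp; ring
    have h2 : N ≤ 2 ^ 184 * c * (J ^ 28 * w ^ 4) * α ^ 3 := by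
      exact le_of_le_mul_div (by positivity) hN h1
    calc N ≤ _ := h2
      _ ≤ 2 ^ 184 * c * (J ^ 28 * w ^ 4) * 8 ^ 3 :=
        mul_le_mul_of_nonneg_left (pow_le_pow_left₀ hα.le hα8 3) (hR 184)
      _ = _ := by ring
  · right; left
    have h1 : (α * N) ^ 8 * q ≤ (α * N) ^ 8 * (2 ^ 178 * c * (J ^ 28 * w ^ 4) * α ^ 5 * N) := by
      calc (α * N) ^ 8 * q ≤ (8 * n) ^ 8 * q := by gcongr
        _ = 8 ^ 8 * n ^ 4 * (q * n ^ 4) := by ring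
        _ ≤ 8 ^ 8 * n ^ 4 * (c * (k ^ 4 * v ^ 4 * U)) := by gcongr
        _ = 8 ^ 8 * c * (k ^ 4 * (v * n) ^ 4 * U) := by ring
        _ ≤ 8 ^ 8 * c * (2 ^ 154 * (J ^ 28 * w ^ 4) * α ^ 13 * N ^ 9) := by
          rw [hvn]; gcongr
        _ = _ := by ring
    calc q ≤ _ := le_of_mul_le_mul_left h1 (by positivity)
      _ ≤ 2 ^ 178 * c * (J ^ 28 * w ^ 4) * 8 ^ 5 * N :=
        mul_le_mul_of_nonneg_right
          (mul_le_mul_of_nonneg_left (pow_le_pow_left₀ hα.le hα8 5) (hR 178)) hN.le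
      _ = _ := by ring
  · right; right
    have h1 : (α * N) ^ 10 ≤ (α * N) ^ 10 * (2 ^ 163 * c * (J ^ 24 * w ^ 5)) / N := by
      calc (α * N) ^ 10 ≤ (8 * n) ^ 10 := by gcongr
        _ = 8 ^ 10 * n ^ 5 * n ^ 5 := by ring
        _ ≤ 8 ^ 10 * n ^ 5 * (c * (k ^ 3 * v ^ 5 * U)) := by gcongr
        _ = 8 ^ 10 * c * (k ^ 3 * (v * n) ^ 5 * U) := by ring
        _ ≤ 8 ^ 10 * c * ((2 ^ 21 * J ^ 4 * α ^ 3 * N) ^ 3 * (w * N) ^ 5 *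
            (2 ^ 70 * J ^ 12 * α * N)) := by
          rw [hvn]; gcongr
        _ = _ := by field_simp; ring
    have h2 : N ≤ 2 ^ 163 * c * (J ^ 24 * w ^ 5) := by
      exact le_of_le_mul_div (by positivity) hN h1
    calc N ≤ _ := h2
      _ ≤ 2 ^ 193 * c * (J ^ 24 * w ^ 5) := by gcongr <;> norm_num

/-- Clearing denominators fixes the exponents: 128 = 4(28 + 4) and 116 = 4(24 + 5), each factor
carrying t⁴N below. -/
theorem pow_bounds_of_card_bounds {N q Y Z t L c : ℝ} (hN : 0 < N) (hq : 0 < q) (ht : 0 < t)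
    (h : N ≤ c * ((L * (q * Y ^ 3 * Z ^ 4 / (t ^ 4 * N))) ^ 28 *
        (q ^ 2 * Y ^ 2 * Z ^ 3 / (t ^ 4 * N)) ^ 4) ∨
      q ≤ c * ((L * (q * Y ^ 3 * Z ^ 4 / (t ^ 4 * N))) ^ 28 *
        (q ^ 2 * Y ^ 2 * Z ^ 3 / (t ^ 4 * N)) ^ 4 * N) ∨
      N ≤ c * ((L * (q * Y ^ 3 * Z ^ 4 / (t ^ 4 * N))) ^ 24 *
        (q ^ 2 * Y ^ 2 * Z ^ 3 / (t ^ 4 * N)) ^ 5)) :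
    (t * N) ^ 128 ≤ c * L ^ 28 * (q ^ 36 * N ^ 95 * Y ^ 92 * Z ^ 124) ∨
      (t * N) ^ 128 ≤ c * L ^ 28 * (q ^ 35 * N ^ 97 * Y ^ 92 * Z ^ 124) ∨
      (t * N) ^ 116 ≤ c * L ^ 24 * (q ^ 34 * N ^ 86 * Y ^ 82 * Z ^ 111) := by
  have e1 : (L * (q * Y ^ 3 * Z ^ 4 / (t ^ 4 * N))) ^ 28 *
      (q ^ 2 * Y ^ 2 * Z ^ 3 / (t ^ 4 * N)) ^ 4 =
      L ^ 28 * (q ^ 36 * N ^ 96 * Y ^ 92 * Z ^ 124) / (t * N) ^ 128 := by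
    field_simp
  have e2 : (L * (q * Y ^ 3 * Z ^ 4 / (t ^ 4 * N))) ^ 24 *
      (q ^ 2 * Y ^ 2 * Z ^ 3 / (t ^ 4 * N)) ^ 5 =
      L ^ 24 * (q ^ 34 * N ^ 87 * Y ^ 82 * Z ^ 111) / (t * N) ^ 116 := by
    field_simp
  rw [e1, e2] at h
  have h128 : 0 < (t * N) ^ 128 := by positivity
  have h116 : 0 < (t * N) ^ 116 := by positivity
  generalize (t * N) ^ 128 = P at *
  generalize (t * N) ^ 116 = Q at *
  rcases h with h | h | h
  · left
    rw [← mul_div_assoc, le_div_iff₀ h128] at h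
    refine le_of_mul_le_mul_left (h.trans_eq ?_) hN
    ring
  · right; left
    rw [← mul_div_right_comm, ← mul_div_assoc, le_div_iff₀ h128] at h
    refine le_of_mul_le_mul_left (h.trans_eq ?_) hq
    ring
  · right; right
    rw [← mul_div_assoc, le_div_iff₀ h116] at h
    refine le_of_mul_le_mul_left (h.trans_eq ?_) hN
    ring

theorem cube_le_of_pow_four_le {t n M E : ℝ} (ht : 0 < t) (hn : 0 < n)
    (h : (t * n) ^ 4 ≤ M * E) : n ^ 3 ≤ M / (t ^ 4 * n) * E := by
  rw [div_mul_eq_mul_div, le_div_iff₀ (by positivity)]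
  exact le_of_eq_of_le (by ring) h

theorem large_values_pow_le {F : Type*} [Field F] [Fintype F] [DecidableEq F] (ψ : AddChar F ℂ)
    (hψ : ψ.IsPrimitive) (A Y Z : Finset F)
    (hA : A.Nonempty) (hA0 : (0 : F) ∉ A) (hZ : (0 : F) ∉ Z) (β γ : F → ℂ)
    (hβ : ∀ y ∈ Y, ‖β y‖ ≤ 1) (hγ : ∀ z ∈ Z, ‖γ z‖ ≤ 1) {t L C : ℝ} (ht : 0 < t)
    (hL : 1 + Real.log ((#A : ℝ) ^ 2) ≤ L)
    (hAt : ∀ x ∈ A, t ≤ ‖∑ y ∈ Y, ∑ z ∈ Z, β y * γ z * ψ (x * y * z)‖)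
    (hC : ∀ G : Subfield F, G ≠ ⊤ → ∀ c : F, ∀ D ⊆ A, (∀ x ∈ D, ∃ g ∈ G, x = c * g) →
      (#D : ℝ) ≤ C * Real.sqrt (Nat.card G)) :
    (t * #A) ^ 128 ≤ 2 ^ 215 * (3 + 2 * C ^ 2) * L ^ 28 *
        ((Fintype.card F : ℝ) ^ 36 * (#A : ℝ) ^ 95 * (#Y : ℝ) ^ 92 * (#Z : ℝ) ^ 124) ∨
      (t * #A) ^ 128 ≤ 2 ^ 215 * (3 + 2 * C ^ 2) * L ^ 28 *
        ((Fintype.card F : ℝ) ^ 35 * (#A : ℝ) ^ 97 * (#Y : ℝ) ^ 92 * (#Z : ℝ) ^ 124) ∨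
      (t * #A) ^ 116 ≤ 2 ^ 215 * (3 + 2 * C ^ 2) * L ^ 24 *
        ((Fintype.card F : ℝ) ^ 34 * (#A : ℝ) ^ 86 * (#Y : ℝ) ^ 82 * (#Z : ℝ) ^ 111) := by
  have hN : (0 : ℝ) < #A := by exact_mod_cast hA.card_pos
  have hN1 : (1 : ℝ) ≤ #A := by exact_mod_cast hA.card_pos
  have hq : (0 : ℝ) < Fintype.card F := by exact_mod_cast Fintype.card_pos
  have hlog : 0 ≤ Real.log ((#A : ℝ) ^ 2) := Real.log_nonneg (one_le_pow₀ hN1)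
  have hκ := cube_le_of_pow_four_le ht hN
    (energies_of_large_sum ψ hψ A Y Z hA0 hZ β γ hβ hγ t ht.le hAt).2
  have hκ0 : 0 ≤ (Fintype.card F : ℝ) * (#Y : ℝ) ^ 3 * (#Z : ℝ) ^ 4 / (t ^ 4 * #A) := by
    positivity
  obtain ⟨α, hα, A', hA'A, hA'α, hk, hU⟩ := balog_szemeredi_gowers A hA _ hκ
  have hn : (0 : ℝ) < #A' := lt_of_lt_of_le (by positivity) hA'α
  have hA' : A'.Nonempty := card_pos.1 (by exact_mod_cast hn)
  have hA'0 : (0 : F) ∉ A' := fun h => hA0 (hA'A h)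
  -- Multiplicative energy is estimated afresh on A', from |g| ≥ t there; it would not pass from A
  -- to A' on its own.
  have hv := cube_le_of_pow_four_le ht hn
    (energies_of_large_sum ψ hψ A' Y Z hA'0 hZ β γ hβ hγ t ht.le fun x hx => hAt x (hA'A hx)).1
  have hsp := sum_product_energy A' hA' hA'0 _ C hv
    fun G hG c D hD => hC G hG c D (hD.trans hA'A)
  have hnN : (#A' : ℝ) ≤ #A := by exact_mod_cast card_le_card hA'A
  have hk0 : (0 : ℝ) ≤ #(A' - A') := Nat.cast_nonneg _
  have hU0 : (0 : ℝ) ≤ #(2 • A' - 2 • A') := Nat.cast_nonneg _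
  have hY0 : (0 : ℝ) ≤ #Y := Nat.cast_nonneg _
  have hZ0 : (0 : ℝ) ≤ #Z := Nat.cast_nonneg _
  generalize (#(A' - A') : ℝ) = k at *
  generalize (#(2 • A' - 2 • A') : ℝ) = U at *
  clear hAt hC hκ hv
  generalize (#A' : ℝ) = n at *
  generalize (#A : ℝ) = N at *
  generalize (#Y : ℝ) = y at *
  generalize (#Z : ℝ) = z at *
  generalize (Fintype.card F : ℝ) = q at *
  refine pow_bounds_of_card_bounds hN hq ht ?_
  set κ := q * y ^ 3 * z ^ 4 / (t ^ 4 * N)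
  have hw : 0 ≤ q ^ 2 * y ^ 2 * z ^ 3 / (t ^ 4 * N) := by positivity
  have hJ : (1 + Real.log (N ^ 2)) * κ ≤ L * κ := by gcongr
  have hJ0 : 0 ≤ (1 + Real.log (N ^ 2)) * κ := by positivity
  generalize (1 + Real.log (N ^ 2)) * κ = J₀ at *
  have hLκ : 0 ≤ L * κ := hJ0.trans hJ
  have hk' : k ≤ 2 ^ 21 * (L * κ) ^ 4 * α ^ 3 * N := hk.trans (by gcongr)
  have hU' : U ≤ 2 ^ 70 * (L * κ) ^ 12 * α * N := hU.trans (by gcongr)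
  have hvw : q ^ 2 * y ^ 2 * z ^ 3 / (t ^ 4 * n) =
      q ^ 2 * y ^ 2 * z ^ 3 / (t ^ 4 * N) * N / n := by field_simp
  have hv0 : 0 ≤ q ^ 2 * y ^ 2 * z ^ 3 / (t ^ 4 * n) := by positivity
  have hres := card_bounds_of_sum_product (c := 2 ^ 22 * (3 + 2 * C ^ 2)) hn hN hα hA'α hnN hw
    hk0 hU0 (by positivity) hq.le hvw hk' hU' ?_
  · convert hres using 3 <;> ring
  generalize q ^ 2 * y ^ 2 * z ^ 3 / (t ^ 4 * n) = v at *
  have hP : 0 ≤ k ^ 4 * v ^ 4 * U := by positivity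
  have hQ : 0 ≤ k ^ 3 * v ^ 5 * U := by positivity
  refine hsp.imp (fun h => h.trans ?_) (Or.imp (fun h => h.trans ?_) (fun h => h.trans ?_))
  · gcongr <;> norm_num
  · refine mul_le_mul_of_nonneg_right ?_ hP
    nlinarith [sq_nonneg C]
  · refine mul_le_mul_of_nonneg_right ?_ hQ
    nlinarith [sq_nonneg C]

theorem card_le_of_smallOnSubfieldDilates {F : Type*} [Field F] [Fintype F] {C : ℝ}
    {X : Finset F} (hX : SmallOnSubfieldDilates C X) (G : Subfield F) (hG : G ≠ ⊤) (c : F)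
    (D : Finset F) (hD : D ⊆ X) (hDG : ∀ x ∈ D, ∃ g ∈ G, x = c * g) :
    (#D : ℝ) ≤ C * Real.sqrt (Nat.card G) := by
  refine le_trans ?_ (hX G hG c)
  rw [← Set.ncard_coe_finset, Nat.cast_le]
  refine Set.ncard_le_ncard (fun x hx => ⟨hD hx, ?_⟩) (Set.toFinite _)
  obtain ⟨g, hg, rfl⟩ := hDG x hx
  exact ⟨g, hg, rfl⟩

theorem norm_sum_sum_le {F : Type*} [Field F] [Fintype F] (ψ : AddChar F ℂ) (Y Z : Finset F)
    (β γ : F → ℂ) (hβ : ∀ y ∈ Y, ‖β y‖ ≤ 1) (hγ : ∀ z ∈ Z, ‖γ z‖ ≤ 1) (x : F) :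
    ‖∑ y ∈ Y, ∑ z ∈ Z, β y * γ z * ψ (x * y * z)‖ ≤ #Y * #Z := by
  have h : ∀ y ∈ Y, ‖∑ z ∈ Z, β y * γ z * ψ (x * y * z)‖ ≤ #Z := fun y hy => by
    refine norm_sum_le_card _ _ fun z hz => ?_
    rw [norm_mul, norm_mul, AddChar.norm_apply, mul_one]
    exact mul_le_one₀ (hβ _ hy) (norm_nonneg _) (hγ _ hz)
  refine (norm_sum_le_of_le _ h).trans ?_
  rw [sum_const, nsmul_eq_mul]

/-- A trilinear sum is either trivially bounded or dominated by a level set of the inner sum. -/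
theorem trilinear_le_level_set {F : Type*} [Field F] [Fintype F] [DecidableEq F] (ψ : AddChar F ℂ)
    (X Y Z : Finset F) (α β γ : F → ℂ) (hα : ∀ x ∈ X, ‖α x‖ ≤ 1)
    (hβ : ∀ y ∈ Y, ‖β y‖ ≤ 1) (hγ : ∀ z ∈ Z, ‖γ z‖ ≤ 1) :
    ‖∑ x ∈ X, ∑ y ∈ Y, ∑ z ∈ Z, α x * β y * γ z * ψ (x * y * z)‖ ≤ 2 * (#Y * #Z) ∨
      ∃ t : ℝ, 0 < t ∧ ∃ A ⊆ X, A.Nonempty ∧ (0 : F) ∉ A ∧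
        (∀ x ∈ A, t ≤ ‖∑ y ∈ Y, ∑ z ∈ Z, β y * γ z * ψ (x * y * z)‖) ∧
        ‖∑ x ∈ X, ∑ y ∈ Y, ∑ z ∈ Z, α x * β y * γ z * ψ (x * y * z)‖ ≤
          2 * ((1 + Real.log #X) * (t * #A)) := by
  set g : F → ℝ := fun x => ‖∑ y ∈ Y, ∑ z ∈ Z, β y * γ z * ψ (x * y * z)‖ with hg
  set S := ‖∑ x ∈ X, ∑ y ∈ Y, ∑ z ∈ Z, α x * β y * γ z * ψ (x * y * z)‖ with hS
  have h1 : S ≤ ∑ x ∈ X, g x := by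
    refine norm_sum_le_of_le _ fun x hx => ?_
    simp only [mul_assoc (α x), ← mul_sum]
    rw [norm_mul]
    exact mul_le_of_le_one_left (norm_nonneg _) (hα x hx)
  -- The term x = 0 is estimated trivially and removed, since quotients need 0 ∉ A.
  have h2 : ∑ x ∈ X, g x ≤ #Y * #Z + ∑ x ∈ X.erase 0, g x := by
    by_cases h0 : (0 : F) ∈ X
    · rw [← add_sum_erase X g h0]
      gcongr
      exact norm_sum_sum_le ψ Y Z β γ hβ hγ 0
    · rw [erase_eq_of_notMem h0]
      exact le_add_of_nonneg_left (by positivity)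
  by_cases hcase : S ≤ 2 * (#Y * #Z)
  · exact Or.inl hcase
  right
  push Not at hcase
  have h3 : S ≤ 2 * ∑ x ∈ X.erase 0, g x := by linarith
  have hYZ : (0 : ℝ) ≤ #Y * #Z := by positivity
  have hpos : 0 < ∑ x ∈ X.erase 0, g x := by linarith
  have hne : (X.erase 0).Nonempty := nonempty_of_sum_ne_zero hpos.ne'
  obtain ⟨t, ht, hsum⟩ := exists_sum_le_log_mul (X.erase 0) hne g hpos
  refine ⟨t, ht, {x ∈ X.erase 0 | t ≤ g x}, (filter_subset _ _).trans (erase_subset _ _), ?_, ?_,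
    fun x hx => (mem_filter.1 hx).2, ?_⟩
  · by_contra hemp
    rw [not_nonempty_iff_eq_empty] at hemp
    rw [hemp] at hsum
    simp at hsum
    linarith
  · exact fun h => notMem_erase 0 X (mem_filter.1 h).1
  · refine h3.trans ?_
    have hcard : (#(X.erase 0) : ℝ) ≤ #X := by exact_mod_cast card_erase_le
    have hcard0 : (0 : ℝ) < #(X.erase 0) := by exact_mod_cast hne.card_pos
    have := Real.log_le_log hcard0 hcard
    gcongr
    exact hsum.trans (by gcongr)

theorem pow_le_of_le_two_mul {S L P N X q Y Z B : ℝ} {m r a b c d : ℕ} (hS : 0 ≤ S)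
    (hN : 0 ≤ N) (hNX : N ≤ X) (hL : 0 ≤ L) (hB : 0 ≤ B) (hq : 0 ≤ q) (hY : 0 ≤ Y)
    (hZ : 0 ≤ Z) (hm : m ≤ 128)
    (hSP : S ≤ 2 * (L * P)) (hP : P ^ m ≤ B * L ^ r * (q ^ a * N ^ b * Y ^ c * Z ^ d)) :
    S ^ m ≤ 2 ^ 128 * B * L ^ (m + r) * (q ^ a * X ^ b * Y ^ c * Z ^ d) := by
  calc S ^ m ≤ (2 * (L * P)) ^ m := by gcongr
    _ = 2 ^ m * L ^ m * P ^ m := by ring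
    _ ≤ 2 ^ m * L ^ m * (B * L ^ r * (q ^ a * N ^ b * Y ^ c * Z ^ d)) := by gcongr
    _ ≤ 2 ^ m * L ^ m * (B * L ^ r * (q ^ a * X ^ b * Y ^ c * Z ^ d)) := by gcongr
    _ = 2 ^ m * B * L ^ (m + r) * (q ^ a * X ^ b * Y ^ c * Z ^ d) := by ring
    _ ≤ _ := by
      have hX : 0 ≤ X := hN.trans hNX
      have hM : 0 ≤ q ^ a * X ^ b * Y ^ c * Z ^ d := by positivity
      have h2 : (2 : ℝ) ^ m ≤ 2 ^ 128 := pow_le_pow_right₀ one_le_two hm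
      gcongr

theorem trilinear_pow_le {F : Type*} [Field F] [Fintype F] (ψ : AddChar F ℂ)
    (hψ : ψ.IsPrimitive) (X Y Z : Finset F) (hZ : (0 : F) ∉ Z) {C : ℝ}
    (hX : SmallOnSubfieldDilates C X) (α β γ : F → ℂ) (hα : ∀ x ∈ X, ‖α x‖ ≤ 1)
    (hβ : ∀ y ∈ Y, ‖β y‖ ≤ 1) (hγ : ∀ z ∈ Z, ‖γ z‖ ≤ 1) {q S L B : ℝ} (hq : q = Fintype.card F)
    (hS : S = ‖∑ x ∈ X, ∑ y ∈ Y, ∑ z ∈ Z, α x * β y * γ z * ψ (x * y * z)‖)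
    (hL : L = 1 + 2 * Real.log q) (hB : B = 2 ^ 128 * (2 ^ 215 * (3 + 2 * C ^ 2))) :
    S ≤ 2 * (#Y * #Z) ∨
    S ^ 128 ≤ B * L ^ 156 * (q ^ 36 * (#X : ℝ) ^ 95 * (#Y : ℝ) ^ 92 * (#Z : ℝ) ^ 124) ∨
      S ^ 128 ≤ B * L ^ 156 * (q ^ 35 * (#X : ℝ) ^ 97 * (#Y : ℝ) ^ 92 * (#Z : ℝ) ^ 124) ∨
      S ^ 116 ≤ B * L ^ 140 * (q ^ 34 * (#X : ℝ) ^ 86 * (#Y : ℝ) ^ 82 * (#Z : ℝ) ^ 111) := by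
  classical
  rcases trilinear_le_level_set ψ X Y Z α β γ hα hβ hγ with h | ⟨t, ht, A, hAX, hA, hA0, hAt, hSA⟩
  · left; rwa [hS]
  right
  have hA1 : (1 : ℝ) ≤ #A := by exact_mod_cast hA.card_pos
  have hAX' : (#A : ℝ) ≤ #X := by exact_mod_cast card_le_card hAX
  have hXq : (#X : ℝ) ≤ q := by rw [hq]; exact_mod_cast card_le_univ X
  -- One L dominates both logarithms: that of |A|² from popular differences and that of |X| from the
  -- level set.
  have hlogA : 1 + Real.log ((#A : ℝ) ^ 2) ≤ L := by
    rw [hL, Real.log_pow]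
    have := Real.log_le_log (by linarith) (hAX'.trans hXq)
    push_cast
    linarith
  have hlogX : 1 + Real.log #X ≤ L := by
    have h1 := Real.log_le_log (by linarith) hXq
    have h2 := Real.log_nonneg (hA1.trans hAX')
    linarith
  have hmain := large_values_pow_le ψ hψ A Y Z hA hA0 hZ β γ hβ hγ ht hlogA hAt
    fun G hG c D hD => card_le_of_smallOnSubfieldDilates hX G hG c D (hD.trans hAX)
  rw [← hS] at hSA
  rw [← hq] at hmain
  have hSP : S ≤ 2 * (L * (t * #A)) := hSA.trans (by gcongr)
  have hS0 : 0 ≤ S := hS ▸ norm_nonneg _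
  have hL0 : 0 ≤ L := by linarith [Real.log_nonneg (hA1.trans hAX')]
  have hq0 : 0 ≤ q := by linarith
  have hB0 : 0 ≤ 2 ^ 215 * (3 + 2 * C ^ 2) := by positivity
  rw [hB]
  have hA0' : (0 : ℝ) ≤ #A := Nat.cast_nonneg _
  have hY0 : (0 : ℝ) ≤ #Y := Nat.cast_nonneg _
  have hZ0 : (0 : ℝ) ≤ #Z := Nat.cast_nonneg _
  exact hmain.imp
    (pow_le_of_le_two_mul hS0 hA0' hAX' hL0 hB0 hq0 hY0 hZ0 (by norm_num) hSP)
    (Or.imp (pow_le_of_le_two_mul hS0 hA0' hAX' hL0 hB0 hq0 hY0 hZ0 (by norm_num) hSP)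
      (pow_le_of_le_two_mul hS0 hA0' hAX' hL0 hB0 hq0 hY0 hZ0 (by norm_num) hSP))

/-! ### Extracting roots and absorbing logarithms -/

/-- Taking m-th roots leaves L^{j/m} ≤ L² and B^{1/m} ≤ B; the uniform exponent 2 covers both
156/128 and 140/116. -/
theorem le_of_pow_le_log_pow {S B L T R : ℝ} {m j : ℕ} (hm : m ≠ 0) (hj : j ≤ 2 * m)
    (hB : 1 ≤ B) (hL : 1 ≤ L) (hT : 0 ≤ T) (h : S ^ m ≤ B * L ^ j * R)
    (hRT : R ≤ T ^ m) : S ≤ B * (L ^ 2 * T) := by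
  refine le_of_not_gt fun hlt => ?_
  have h1 : (B * (L ^ 2 * T)) ^ m < S ^ m := pow_lt_pow_left₀ hlt (by positivity) hm
  have h2 : S ^ m ≤ (B * (L ^ 2 * T)) ^ m := by
    calc S ^ m ≤ B * L ^ j * T ^ m := h.trans (by gcongr)
      _ ≤ B ^ m * L ^ (2 * m) * T ^ m := by
        have := le_self_pow₀ hB hm
        gcongr
      _ = _ := by rw [mul_pow, mul_pow, ← pow_mul]; ring
  linarith

/-- The exponent by which the squared logarithmic factor is a power of `q`. -/
noncomputable def logExponent (q : ℕ) : ℝ := 2 * Real.log (1 + 2 * Real.log q) / Real.log q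

theorem tendsto_logExponent : Filter.Tendsto logExponent Filter.atTop (nhds 0) := by
  have h1 : Filter.Tendsto (fun q : ℕ => Real.log q) Filter.atTop Filter.atTop :=
    Real.tendsto_log_atTop.comp tendsto_natCast_atTop_atTop
  have h2 : Filter.Tendsto (fun u : ℝ => 2 * Real.log (1 + 2 * u) / u) Filter.atTop (nhds 0) := by
    have h3 : Filter.Tendsto (fun u : ℝ => 1 + 2 * u) Filter.atTop Filter.atTop :=
      Filter.tendsto_atTop_add_const_left _ _
        (Filter.tendsto_id.const_mul_atTop (by norm_num : (0 : ℝ) < 2))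
    have h4 := (Real.isLittleO_log_id_atTop.comp_tendsto h3)
    have h5 : (fun u : ℝ => 1 + 2 * u) =O[Filter.atTop] (fun u : ℝ => u) := by
      refine Asymptotics.IsBigO.of_bound 3 ?_
      filter_upwards [Filter.eventually_ge_atTop 1] with u hu
      rw [Real.norm_of_nonneg (by linarith), Real.norm_of_nonneg (by linarith)]
      linarith
    exact ((h4.trans_isBigO h5).const_mul_left 2).tendsto_div_nhds_zero
  exact h2.comp h1

/-- The exponent is defined so that its power of q equals the squared logarithmic factor exactly. -/
theorem rpow_add_logExponent {q : ℕ} (hq : 2 ≤ q) (s : ℝ) :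
    (q : ℝ) ^ (s + logExponent q) = (q : ℝ) ^ s * (1 + 2 * Real.log q) ^ 2 := by
  have hq1 : (1 : ℝ) < q := by exact_mod_cast hq
  have hlog := Real.log_pos hq1
  rw [Real.rpow_add (by linarith)]
  congr 1
  rw [Real.rpow_def_of_pos (by linarith), logExponent, mul_div_cancel₀ _ hlog.ne', two_mul,
    Real.exp_add, Real.exp_log (by linarith), sq]

theorem rpow_div_pow {x : ℝ} (hx : 0 ≤ x) (a b : ℕ) (s : ℝ) (hs : s * b = a) :
    (x ^ s) ^ b = x ^ a := by
  rw [← Real.rpow_natCast, ← Real.rpow_mul hx, hs, Real.rpow_natCast]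

theorem mul_pow_mul_pow_le {R y z : ℝ} (hR : 0 ≤ R) (hz : 0 ≤ z) (hzy : z ≤ y) (i j l : ℕ) :
    R * y ^ i * z ^ (j + l) ≤ R * y ^ (i + l) * z ^ j := by
  have hy : 0 ≤ y := hz.trans hzy
  calc R * y ^ i * z ^ (j + l) = R * y ^ i * z ^ j * z ^ l := by ring
    _ ≤ R * y ^ i * z ^ j * y ^ l := by gcongr
    _ = _ := by ring

/-- This absorbs the trivial bound |Y||Z| into the first term. The dichotomy for x reflects that it
is a cardinality, which allows its exponent to be raised from 32 to 95. -/
theorem mul_pow_le_of_card_bounds {Q x y z : ℝ} (hQ : 1 ≤ Q) (hz : 0 ≤ z) (hzy : z ≤ y)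
    (hyx : y ≤ x) (hxQ : x ≤ Q) (hx : x = 0 ∨ 1 ≤ x) :
    (y * z) ^ 128 ≤ Q ^ 36 * x ^ 95 * y ^ 96 * z ^ 120 := by
  have hy : 0 ≤ y := hz.trans hzy
  have hyx32 : y ^ 32 ≤ x ^ 95 := by
    rcases hx with rfl | hx
    · rw [le_antisymm hyx hy]
      norm_num
    · exact (pow_le_pow_left₀ hy hyx 32).trans (pow_le_pow_right₀ hx (by norm_num))
  have hzQ : z ^ 8 ≤ Q ^ 36 :=
    (pow_le_pow_left₀ hz (by linarith) 8).trans (pow_le_pow_right₀ hQ (by norm_num))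
  have hzy' : z ^ 8 * y ^ 32 ≤ Q ^ 36 * x ^ 95 :=
    mul_le_mul hzQ hyx32 (pow_nonneg hy _) (pow_nonneg (by linarith) _)
  calc (y * z) ^ 128 = z ^ 8 * y ^ 32 * y ^ 96 * z ^ 120 := by ring
    _ ≤ _ := mul_le_mul_of_nonneg_right (mul_le_mul_of_nonneg_right hzy' (pow_nonneg hy _))
      (pow_nonneg hz _)

theorem le_three_terms {q : ℕ} (hq : 2 ≤ q) {S x y z B : ℝ} (hz : 0 ≤ z) (hzy : z ≤ y)
    (hyx : y ≤ x) (hxq : x ≤ q) (hx : x = 0 ∨ 1 ≤ x) (hB : 2 ≤ B)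
    (h : S ≤ 2 * (y * z) ∨
      S ^ 128 ≤ B * (1 + 2 * Real.log q) ^ 156 * (q ^ 36 * x ^ 95 * y ^ 92 * z ^ 124) ∨
      S ^ 128 ≤ B * (1 + 2 * Real.log q) ^ 156 * (q ^ 35 * x ^ 97 * y ^ 92 * z ^ 124) ∨
      S ^ 116 ≤ B * (1 + 2 * Real.log q) ^ 140 * (q ^ 34 * x ^ 86 * y ^ 82 * z ^ 111)) :
    S ≤ B * ((q : ℝ) ^ ((9 : ℝ) / 32 + logExponent q) * x ^ ((95 : ℝ) / 128) *
                  y ^ ((3 : ℝ) / 4) * z ^ ((15 : ℝ) / 16) +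
                (q : ℝ) ^ ((17 : ℝ) / 58 + logExponent q) * x ^ ((43 : ℝ) / 58) *
                  y ^ ((87 : ℝ) / 116) * z ^ ((53 : ℝ) / 58) +
                (q : ℝ) ^ ((35 : ℝ) / 128 + logExponent q) * x ^ ((97 : ℝ) / 128) *
                  y ^ ((3 : ℝ) / 4) * z ^ ((15 : ℝ) / 16)) := by
  rw [rpow_add_logExponent hq, rpow_add_logExponent hq, rpow_add_logExponent hq]
  have hq1 : (1 : ℝ) ≤ q := by exact_mod_cast (by omega : 1 ≤ q)
  have hL : 1 ≤ 1 + 2 * Real.log q := by linarith [Real.log_nonneg hq1]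
  generalize 1 + 2 * Real.log q = L at *
  generalize (q : ℝ) = Q at *
  have hy : 0 ≤ y := hz.trans hzy
  have hx0 : 0 ≤ x := hy.trans hyx
  have hQ0 : 0 ≤ Q := by linarith
  set T₁ := Q ^ ((9 : ℝ) / 32) * x ^ ((95 : ℝ) / 128) * y ^ ((3 : ℝ) / 4) * z ^ ((15 : ℝ) / 16)
    with hT₁
  set T₂ := Q ^ ((17 : ℝ) / 58) * x ^ ((43 : ℝ) / 58) * y ^ ((87 : ℝ) / 116) * z ^ ((53 : ℝ) / 58)
    with hT₂
  set T₃ := Q ^ ((35 : ℝ) / 128) * x ^ ((97 : ℝ) / 128) * y ^ ((3 : ℝ) / 4) * z ^ ((15 : ℝ) / 16)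
    with hT₃
  have hT₁0 : 0 ≤ T₁ := by positivity
  have hT₂0 : 0 ≤ T₂ := by positivity
  have hT₃0 : 0 ≤ T₃ := by positivity
  have hp₁ : T₁ ^ 128 = Q ^ 36 * x ^ 95 * y ^ 96 * z ^ 120 := by
    rw [hT₁, mul_pow, mul_pow, mul_pow, rpow_div_pow hQ0 36, rpow_div_pow hx0 95,
      rpow_div_pow hy 96, rpow_div_pow hz 120] <;> norm_num
  have hp₂ : T₂ ^ 116 = Q ^ 34 * x ^ 86 * y ^ 87 * z ^ 106 := by
    rw [hT₂, mul_pow, mul_pow, mul_pow, rpow_div_pow hQ0 34, rpow_div_pow hx0 86,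
      rpow_div_pow hy 87, rpow_div_pow hz 106] <;> norm_num
  have hp₃ : T₃ ^ 128 = Q ^ 35 * x ^ 97 * y ^ 96 * z ^ 120 := by
    rw [hT₃, mul_pow, mul_pow, mul_pow, rpow_div_pow hQ0 35, rpow_div_pow hx0 97,
      rpow_div_pow hy 96, rpow_div_pow hz 120] <;> norm_num
  have hsum : S ≤ B * (L ^ 2 * T₁) ∨ S ≤ B * (L ^ 2 * T₂) ∨ S ≤ B * (L ^ 2 * T₃) := by
    rcases h with h | h | h | h
    · left
      have hYZ : y * z ≤ T₁ := by
        refine le_of_not_gt fun hlt => ?_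
        have hlt' := pow_lt_pow_left₀ hlt hT₁0 (by norm_num : 128 ≠ 0)
        rw [hp₁] at hlt'
        exact absurd hlt' (not_lt.2 (mul_pow_le_of_card_bounds hq1 hz hzy hyx hxq hx))
      calc S ≤ 2 * (y * z) := h
        _ ≤ B * (L ^ 2 * T₁) :=
          mul_le_mul hB (hYZ.trans (le_mul_of_one_le_left hT₁0 (one_le_pow₀ hL)))
            (mul_nonneg hy hz) (by linarith)
    · left
      refine le_of_pow_le_log_pow (by norm_num) (by norm_num) (by linarith) hL hT₁0 h ?_
      rw [hp₁]
      -- Four powers of z become powers of y, turning 92 and 124 into 96 and 120, which give the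
      -- exponents 3/4 and 15/16; in the middle term five are traded.
      exact mul_pow_mul_pow_le (mul_nonneg (pow_nonneg hQ0 _) (pow_nonneg hx0 _)) hz hzy 92 120 4
    · right; right
      refine le_of_pow_le_log_pow (by norm_num) (by norm_num) (by linarith) hL hT₃0 h ?_
      rw [hp₃]
      exact mul_pow_mul_pow_le (mul_nonneg (pow_nonneg hQ0 _) (pow_nonneg hx0 _)) hz hzy 92 120 4
    · right; left
      refine le_of_pow_le_log_pow (by norm_num) (by norm_num) (by linarith) hL hT₂0 h ?_
      rw [hp₂]
      exact mul_pow_mul_pow_le (mul_nonneg (pow_nonneg hQ0 _) (pow_nonneg hx0 _)) hz hzy 82 106 5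
  have hL0 : 0 ≤ L := by linarith
  have hB0 : 0 ≤ B := by linarith
  have h1 : 0 ≤ B * (L ^ 2 * T₁) := by positivity
  have h2 : 0 ≤ B * (L ^ 2 * T₂) := by positivity
  have h3 : 0 ≤ B * (L ^ 2 * T₃) := by positivity
  have htot : S ≤ B * (L ^ 2 * T₁) + B * (L ^ 2 * T₂) + B * (L ^ 2 * T₃) := by
    rcases hsum with h | h | h <;> linarith
  refine htot.trans_eq ?_
  rw [hT₁, hT₂, hT₃]
  ring

end TrilinearSum

/-! ### The trilinear estimate -/

theorem theorem4 :
    ∃ e : ℕ → ℝ, Filter.Tendsto e Filter.atTop (nhds 0) ∧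
      ∀ C : ℝ, 0 < C → ∃ K : ℝ, 0 < K ∧
        ∀ (p : ℕ) [Fact p.Prime] (F : Type*) [Field F] [Fintype F] [Algebra (ZMod p) F]
          (q : ℕ) (_hq : q = Fintype.card F)
          (X Y Z : Finset F) (_hXY : Y.card ≤ X.card) (_hYZ : Z.card ≤ Y.card)
          (_hZ : (0 : F) ∉ Z) (_hX : SmallOnSubfieldDilates C X)
          (α β γ : F → ℂ) (_hα : ∀ x ∈ X, ‖α x‖ ≤ 1) (_hβ : ∀ y ∈ Y, ‖β y‖ ≤ 1)
          (_hγ : ∀ z ∈ Z, ‖γ z‖ ≤ 1),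
          ‖∑ x ∈ X, ∑ y ∈ Y, ∑ z ∈ Z, α x * β y * γ z * canonicalChar p F (x * y * z)‖ ≤
            K * ((q : ℝ) ^ ((9 : ℝ) / 32 + e q) * (X.card : ℝ) ^ ((95 : ℝ) / 128) *
                  (Y.card : ℝ) ^ ((3 : ℝ) / 4) * (Z.card : ℝ) ^ ((15 : ℝ) / 16) +
                (q : ℝ) ^ ((17 : ℝ) / 58 + e q) * (X.card : ℝ) ^ ((43 : ℝ) / 58) *
                  (Y.card : ℝ) ^ ((87 : ℝ) / 116) * (Z.card : ℝ) ^ ((53 : ℝ) / 58) +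
                (q : ℝ) ^ ((35 : ℝ) / 128 + e q) * (X.card : ℝ) ^ ((97 : ℝ) / 128) *
                  (Y.card : ℝ) ^ ((3 : ℝ) / 4) * (Z.card : ℝ) ^ ((15 : ℝ) / 16)) := by
  refine ⟨TrilinearSum.logExponent, TrilinearSum.tendsto_logExponent, fun C _ =>
    ⟨2 ^ 128 * (2 ^ 215 * (3 + 2 * C ^ 2)), by positivity, ?_⟩⟩
  intro p _ F _ _ _ q hq X Y Z hXY hYZ hZ hX α β γ hα hβ hγ
  obtain ⟨ψ, hψ, hψc⟩ := TrilinearSum.exists_addChar_eq_canonicalChar p F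
  have hq2 : 2 ≤ q := hq ▸ Fintype.one_lt_card
  have hx : (X.card : ℝ) = 0 ∨ (1 : ℝ) ≤ X.card := by
    rcases Nat.eq_zero_or_pos X.card with h | h
    · left; exact_mod_cast h
    · right; exact_mod_cast h
  have hB : (2 : ℝ) ≤ 2 ^ 128 * (2 ^ 215 * (3 + 2 * C ^ 2)) := by
    nlinarith [sq_nonneg C]
  refine TrilinearSum.le_three_terms hq2 (Nat.cast_nonneg _) (by exact_mod_cast hYZ)
    (by exact_mod_cast hXY) (by rw [hq]; exact_mod_cast Finset.card_le_univ X) hx hB ?_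
  simp only [hψc]
  exact TrilinearSum.trilinear_pow_le ψ hψ X Y Z hZ hX α β γ hα hβ hγ (by rw [hq]) rfl rfl rfl
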